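/- Let $\mathcal X$ be a finite non-empty alphabet and $\beta>0$. Logarithms are to base 2, $H$ is Shannon entropy, and for a distribution $p$ on $\mathcal X$ the sequence $X^n=(X_1,\dots,X_n)$ is i.i.d. with letter distribution $p$ (a discrete memoryless source, DMS). An $(n,2^{d})$ uniform source code of length $m$ is a pair of maps $\phi:\mathcal X^n\times\mathcal U\to\{0,1\}^m$, $\psi:\{0,1\}^m\times\mathcal U\to\mathcal X^n$, where $|\mathcal U|=2^{d}$; the seed $U$ is uniform on $\mathcal U$, independent of $X^n$, known to encoder and decoder, and $d$ is its length. The uniformity error of the code for $p$ is the Kullback--Leibler divergence $U_e(\phi)=\mathbb D(p_{\phi(X^n,U)}\,\|\,\mathrm{unif}(\{0,1\}^m))$. An adaptive code of blocklength $n$ is a finite set $\mathcal S_n$ of $(n,2^{d_n})$ uniform source codes (possibly of different lengths), with two selection rules: the encoder chooses a code $f_n(x^n)\in\mathcal S_n$ from the sequence $x^n$ to be encoded and sends the output $M$ of its encoding map $\phi_n$; the decoder chooses a code $g_n(M)\in\mathcal S_n$ from the binary sequence $M$ (whose length it sees) and applies its decoding map $\psi_n$ to $M$ and $U$. Let $P_e$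 be the probability that the decoder does not recover $X^n$; let $m(X^n)$ be the length, $R_n(X^n)=m(X^n)/n$ the rate, and $U_e(\phi_n)$ the uniformity error, of the selected code $f_n(X^n)$. The last three are random variables through $X^n$. There are seed lengths $d_n$ and adaptive codes $(\mathcal S_n,f_n,g_n)$, $n\in\mathbb N$, depending only on $\mathcal X$ and $\beta$, such that $d_n=\Theta(n^{1/2+\beta})$; $f_n(x^n)$ depends on $x^n$ only through the plug-in entropy estimate, i.e. the entropy of the empirical distribution of $x^n$; $g_n(M)=f_n(x^n)$ for all $x^n$ and all seed values; and for every DMS on $\mathcal X$, with distribution $p_X$ and entropy $H(X)$ (both unknown to the code), $$\lim_{n\to\infty}P_e=0,\qquad \operatorname*{plim}_{n\to\infty}U_e(\phi_n)=0,\qquad \operatorname*{plim}_{n\to\infty}R_n(X^n)=H(X),$$ and, more precisely, $\lim_{n\to\infty}\mathbb P[U_e(\phi_n)\le n^{-r}]=1$ for every $r>0$. Moreover the asymptotic rate $H(X)$ is optimal for every DMS on $\mathcal X$. First, $H(X)$ is the smallest achievable rate, where $R$ is achievable if there is a sequence of adaptive codes with $P_e\to0$, $U_e(\phi_n)\to0$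 in probability, $d_n/n\to0$, and $\mathbb P[m(X^n)/n>R+\epsilon]\to0$ for all $\epsilon>0$. Second, every sequence of adaptive codes, with any seed lengths, for which $P_e\to0$ and $U_e(\phi_n)\to0$ in probability satisfies $\mathbb P[m(X^n)/n<H(X)-\epsilon]\to0$ for all $\epsilon>0$. -/

import Mathlib

open Filter Topology Asymptotics

/-- Shannon entropy, in bits, of a probability vector `p` on a finite alphabet
(`Real.negMulLog t = -t * log t`, which is `0` at `t = 0`). -/
noncomputable def shannonEntropy {A : Type*} [Fintype A] (p : A → ℝ) : ℝ :=
  ∑ a, Real.negMulLog (p a) / Real.log 2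

/-- Kullback-Leibler divergence `D(p ‖ q)`, in bits, of two probability vectors on a finite set.
It is used only for a reference vector `q` that is everywhere positive, where it is finite;
the terms with `p a = 0` vanish. -/
noncomputable def klDivBits {A : Type*} [Fintype A] (p q : A → ℝ) : ℝ :=
  ∑ a, p a * Real.logb 2 (p a / q a)

/-- Probability of the sequence `x` under the discrete memoryless source with letter
distribution `p`. -/
noncomputable def seqProb {A : Type*} (p : A → ℝ) {n : ℕ} (x : Fin n → A) : ℝ :=
  ∏ i, p (x i)

open scoped Classical in
/-- `ℙ[E(Xⁿ)]` for `Xⁿ` emitted by the discrete memoryless source with letter distribution `p`. -/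
noncomputable def sourceProb {A : Type*} [Fintype A] (p : A → ℝ) {n : ℕ}
    (E : (Fin n → A) → Prop) : ℝ :=
  ∑ x : Fin n → A, if E x then seqProb p x else 0

open scoped Classical in
/-- `ℙ[E(Xⁿ, U)]` for `Xⁿ` emitted by the discrete memoryless source with letter distribution `p`
and an independent seed `U`, uniform on a set of `2 ^ d` elements. -/
noncomputable def sourceSeedProb {A : Type*} [Fintype A] (p : A → ℝ) {n d : ℕ}
    (E : (Fin n → A) → Fin (2 ^ d) → Prop) : ℝ :=
  ∑ x : Fin n → A, ∑ u : Fin (2 ^ d), if E x u then seqProb p x * ((2 : ℝ) ^ d)⁻¹ else 0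

/-- Convergence in probability to the constant `c` of the random variables `Z n (Xⁿ)`. -/
def SourceTendstoInProb {A : Type*} [Fintype A] (p : A → ℝ)
    (Z : ∀ n : ℕ, (Fin n → A) → ℝ) (c : ℝ) : Prop :=
  ∀ ε : ℝ, 0 < ε → Tendsto (fun n => sourceProb p (fun x => ε < |Z n x - c|)) atTop (𝓝 0)

open scoped Classical in
/-- The type (empirical distribution) of the sequence `x`. -/
noncomputable def empiricalDist {A : Type*} {n : ℕ} (x : Fin n → A) (a : A) : ℝ :=
  ((Finset.univ.filter (fun i => x i = a)).card : ℝ) / n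

/-- The plug-in estimate of the entropy of the source from the sequence `x`. -/
noncomputable def plugInEntropy {A : Type*} [Fintype A] {n : ℕ} (x : Fin n → A) : ℝ :=
  shannonEntropy (empiricalDist x)

/-- Finite binary sequences of arbitrary length. -/
abbrev BitString : Type := Σ m : ℕ, (Fin m → Bool)

/-- An `(n, 2 ^ d)` uniform source code with output length `len`: an encoder and a decoder
that share a seed of `d` bits. -/
structure UniformSourceCode (A : Type*) (n d : ℕ) where
  len : ℕ
  enc : (Fin n → A) → Fin (2 ^ d) → (Fin len → Bool)
  dec : (Fin len → Bool) → Fin (2 ^ d) → (Fin n → A)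

namespace UniformSourceCode

variable {A : Type*} {n d : ℕ}

/-- The encoder output as a binary sequence that carries its length. -/
def output (c : UniformSourceCode A n d) (x : Fin n → A) (u : Fin (2 ^ d)) : BitString :=
  ⟨c.len, c.enc x u⟩

/-- The binary sequence `w` has the length on which the decoder of `c` operates, and this decoder
maps `w`, with the seed `u`, to `x`. -/
def DecodesTo (c : UniformSourceCode A n d) (w : BitString) (u : Fin (2 ^ d))
    (x : Fin n → A) : Prop :=
  ∃ h : w.1 = c.len, c.dec (fun i => w.2 (Fin.cast h.symm i)) u = x

/-- The distribution of the output of the encoder of `c` when its input is `(Xⁿ, U)`. -/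
noncomputable def outputDist [Fintype A] (c : UniformSourceCode A n d) (p : A → ℝ)
    (w : Fin c.len → Bool) : ℝ :=
  sourceSeedProb p (fun x (u : Fin (2 ^ d)) => c.enc x u = w)

/-- `U_e`: the divergence between the output distribution of the encoder of `c` and the uniform
distribution on binary sequences of length `c.len`. -/
noncomputable def uniformityError [Fintype A] (c : UniformSourceCode A n d) (p : A → ℝ) : ℝ :=
  klDivBits (c.outputDist p) (fun _ => ((2 : ℝ) ^ c.len)⁻¹)

end UniformSourceCode

/-- Blocklength-`n` coding with a code that depends on the sequence to encode: a finite set of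
uniform source codes, a rule by which the encoder selects a code of the set from the source
sequence, and a rule by which the decoder selects a code of the set from the compressed sequence.
Nothing here depends on the source distribution. -/
structure AdaptiveCode (A : Type*) (n d : ℕ) where
  codes : Finset (UniformSourceCode A n d)
  encSel : (Fin n → A) → UniformSourceCode A n d
  decSel : BitString → UniformSourceCode A n d
  encSel_mem : ∀ x, encSel x ∈ codes
  decSel_mem : ∀ w, decSel w ∈ codes

namespace AdaptiveCode

variable {A : Type*} {n d : ℕ}

/-- The compressed sequence `M`. -/
def message (C : AdaptiveCode A n d) (x : Fin n → A) (u : Fin (2 ^ d)) : BitString :=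
  (C.encSel x).output x u

/-- The rate `m(xⁿ) / n`, in bits per source symbol, of the code used for `xⁿ`. -/
noncomputable def rate (C : AdaptiveCode A n d) (x : Fin n → A) : ℝ :=
  ((C.encSel x).len : ℝ) / n

/-- `P_e`: the probability that the decoder, which sees only the compressed sequence and the
seed, does not recover the source sequence. -/
noncomputable def errorProb [Fintype A] (C : AdaptiveCode A n d) (p : A → ℝ) : ℝ :=
  sourceSeedProb p (fun x (u : Fin (2 ^ d)) =>
    ¬ (C.decSel (C.message x u)).DecodesTo (C.message x u) u x)

/-- `U_e` of the code selected for the sequence `x`, a random variable through `x`. -/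
noncomputable def uniformityError [Fintype A] (C : AdaptiveCode A n d) (p : A → ℝ)
    (x : Fin n → A) : ℝ :=
  (C.encSel x).uniformityError p

end AdaptiveCode

/-- `R` is an achievable rate, for the source with letter distribution `p`, in lossless source
coding with nearly uniform output and a seed of vanishing rate. -/
def AchievableRate {A : Type*} [Fintype A] (p : A → ℝ) (R : ℝ) : Prop :=
  ∃ (d : ℕ → ℕ) (C : ∀ n, AdaptiveCode A n (d n)),
    (∀ ε : ℝ, 0 < ε →
      Tendsto (fun n => sourceProb p (fun x => R + ε < (C n).rate x)) atTop (𝓝 0)) ∧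
    Tendsto (fun n => (C n).errorProb p) atTop (𝓝 0) ∧
    SourceTendstoInProb p (fun n x => (C n).uniformityError p x) 0 ∧
    Tendsto (fun n => (d n : ℝ) / n) atTop (𝓝 0)

/-! Given its type, `Xⁿ` is uniform on a type class, whatever the source. So a hash `h` into `b`
bits that is balanced on every type class has an almost uniform output as soon as the classes are
much larger than `2 ^ b`, and this needs no knowledge of `p`. Convexity of divergence passes from
single types to their mixture; the types with small classes cost at most `b` bits each and have
negligible total mass (`sum_image_mul_logb_le`, `sourceProb_typeCard_lt_le`).

What `h` forgets is put in a short label that separates the sequences with equal hash. The label is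
masked by the seed as by a one-time pad, hence is exactly uniform, independent of `h`, and adds no
divergence (`exists_padded_code`).

The number `b` is `n` times the plug-in entropy, rounded down, minus a margin `a` of order `n ^ t`
with `1 / 2 < t < 1`. The margin exceeds the fluctuations of the plug-in estimate and so keeps `2 ^
b` far below the typical class size, yet it is `o(n)`. A label of `2 * a` bits beats both the `a`
bits removed and the polynomial number of types, so decoding is eventually free of error. The
decoder reads `b` off the message length.

For the converse, for each seed value a correctly decoded sequence is determined by its message, and
there are too few short messages to carry the typical set (`AdaptiveCode.sourceProb_len_lt_le`). -/

/-! ### Method of types -/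

section Types

variable {A : Type*} {n : ℕ}

open scoped Classical in
/-- The vector of the numbers of occurrences of the letters in the sequence `x`. -/
noncomputable def letterCounts (x : Fin n → A) (a : A) : Fin (n + 1) :=
  ⟨(Finset.univ.filter (fun i => x i = a)).card,
    Nat.lt_succ_of_le ((Finset.card_le_univ _).trans_eq (Fintype.card_fin n))⟩

open scoped Classical in
/-- The number of sequences of the same type as `x`. -/
noncomputable def typeCard [Fintype A] (x : Fin n → A) : ℕ :=
  (Finset.univ.filter (fun y => letterCounts y = letterCounts x)).card

theorem empiricalDist_eq (x : Fin n → A) (a : A) :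
    empiricalDist x a = (letterCounts x a : ℕ) / (n : ℝ) := rfl

theorem seqProb_eq_prod_pow [Fintype A] (p : A → ℝ) (x : Fin n → A) :
    seqProb p x = ∏ a, p a ^ (letterCounts x a : ℕ) := by
  classical
  unfold seqProb
  rw [← Finset.prod_fiberwise (s := Finset.univ) (g := x)]
  refine Finset.prod_congr rfl fun a _ => ?_
  rw [Finset.prod_congr rfl (g := fun _ => p a)]
  · rw [Finset.prod_const]
    congr 1
  · intro i hi
    rw [(Finset.mem_filter.1 hi).2]

theorem seqProb_congr [Fintype A] (p : A → ℝ) {x y : Fin n → A}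
    (h : letterCounts x = letterCounts y) : seqProb p x = seqProb p y := by
  rw [seqProb_eq_prod_pow, seqProb_eq_prod_pow, h]

theorem seqProb_nonneg [Fintype A] {p : A → ℝ} (hp : p ∈ stdSimplex ℝ A) (x : Fin n → A) :
    0 ≤ seqProb p x :=
  Finset.prod_nonneg fun _ _ => hp.1 _

/-- Independence of the letters. The case `f = 1` is normalization, and exponential `f` gives the
moment generating function in the Chernoff bound. -/
theorem sum_seqProb_mul_prod [Fintype A] (p f : A → ℝ) :
    ∑ x : Fin n → A, seqProb p x * ∏ i, f (x i) = (∑ a, p a * f a) ^ n := by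
  classical
  have := Finset.prod_univ_sum (fun _ : Fin n => (Finset.univ : Finset A))
    (fun _ a => p a * f a)
  simp only [Finset.prod_const, Finset.card_univ, Fintype.card_fin, Fintype.piFinset_univ] at this
  rw [this]
  refine Finset.sum_congr rfl fun x _ => ?_
  rw [seqProb, Finset.prod_mul_distrib]

theorem sum_seqProb [Fintype A] {p : A → ℝ} (hp : p ∈ stdSimplex ℝ A) :
    ∑ x : Fin n → A, seqProb p x = 1 := by
  simpa [hp.2] using sum_seqProb_mul_prod (n := n) p (fun _ => 1)

theorem sum_letterCounts [Fintype A] (x : Fin n → A) :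
    ∑ a, ((letterCounts x a : ℕ) : ℝ) = n := by
  classical
  have := Finset.card_eq_sum_card_fiberwise (f := x) (s := Finset.univ) (t := Finset.univ)
    (fun _ _ => by simp)
  rw [Finset.card_univ, Fintype.card_fin] at this
  have h2 : (n : ℝ) = ∑ a, (((Finset.univ.filter (fun i => x i = a)).card : ℕ) : ℝ) := by
    exact_mod_cast this
  rw [h2]
  exact Finset.sum_congr rfl fun a _ => rfl

theorem empiricalDist_mem_stdSimplex [Fintype A] (hn : n ≠ 0) (x : Fin n → A) :
    empiricalDist x ∈ stdSimplex ℝ A := by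
  refine ⟨fun a => by rw [empiricalDist_eq]; positivity, ?_⟩
  simp only [empiricalDist_eq]
  rw [← Finset.sum_div, sum_letterCounts, div_self (by exact_mod_cast hn)]

theorem seqProb_empiricalDist [Fintype A] (x : Fin n → A) :
    seqProb (empiricalDist x) x = (2 : ℝ) ^ (-(n * plugInEntropy x)) := by
  rw [seqProb_eq_prod_pow]
  have h : ∀ a, empiricalDist x a ^ (letterCounts x a : ℕ)
      = Real.exp (-(n * Real.negMulLog (empiricalDist x a))) := by
    intro a
    by_cases h0 : (letterCounts x a : ℕ) = 0
    · rw [empiricalDist_eq, h0]; simp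
    have hn : (n : ℝ) ≠ 0 := by
      have := (letterCounts x a).2
      have : n ≠ 0 := by omega
      exact_mod_cast this
    have hpos : 0 < empiricalDist x a := by
      rw [empiricalDist_eq]
      have : 0 < (letterCounts x a : ℕ) := Nat.pos_of_ne_zero h0
      have : 0 < n := by exact_mod_cast (lt_of_le_of_ne (Nat.zero_le _) (by exact_mod_cast hn.symm))
      positivity
    rw [← Real.exp_log (pow_pos hpos _), Real.log_pow, Real.negMulLog]
    congr 1
    have : ((letterCounts x a : ℕ) : ℝ) = n * empiricalDist x a := by
      rw [empiricalDist_eq]; field_simp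
    rw [this]; ring
  rw [Finset.prod_congr rfl fun a _ => h a, ← Real.exp_sum,
    Real.rpow_def_of_pos (by norm_num)]
  congr 1
  unfold plugInEntropy shannonEntropy
  have : Real.log 2 ≠ 0 := by positivity
  rw [Finset.sum_neg_distrib, ← Finset.mul_sum, ← Finset.sum_div]
  field_simp

/-- Under the memoryless source whose letter distribution is the type of `x`, every member of the
class has the probability in `seqProb_empiricalDist`, and these probabilities sum to at most 1. -/
theorem typeCard_le_rpow [Fintype A] (x : Fin n → A) :
    (typeCard x : ℝ) ≤ (2 : ℝ) ^ (n * plugInEntropy x) := by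
  classical
  have key : typeCard x * seqProb (empiricalDist x) x ≤ 1 := by
    rcases eq_or_ne n 0 with rfl | hn
    · have : typeCard x ≤ 1 := (Finset.card_le_univ _).trans_eq (by simp)
      simpa [seqProb] using this
    · have hq := empiricalDist_mem_stdSimplex hn x
      rw [← sum_seqProb (n := n) hq, typeCard, ← nsmul_eq_mul, ← Finset.sum_const]
      rw [Finset.sum_congr rfl fun y hy =>
        (seqProb_congr (empiricalDist x) (Finset.mem_filter.1 hy).2).symm]
      exact Finset.sum_le_univ_sum_of_nonneg fun y => seqProb_nonneg hq y
  rw [seqProb_empiricalDist, Real.rpow_neg (by norm_num)] at key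
  rwa [← div_eq_mul_inv, div_le_one (by positivity)] at key

end Types

/-! ### Balanced hashes and separating labels -/

section Balanced

variable {X T : Type*} [Fintype X]

theorem card_filter_mod_le (N B w : ℕ) :
    (Finset.univ.filter (fun j : Fin N => (j : ℕ) % B = w)).card ≤ N / B + 1 := by
  rw [← Finset.card_range (N / B + 1)]
  refine Finset.card_le_card_of_injOn (fun j : Fin N => (j : ℕ) / B) ?_ ?_
  · intro j _
    simp only [Finset.coe_range, Set.mem_Iio]
    exact Nat.lt_succ_of_le (Nat.div_le_div_right j.2.le)
  · intro i hi j hj hij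
    simp only [Finset.coe_filter, Finset.mem_univ, true_and, Set.mem_ofPred_eq] at hi hj hij
    ext
    rw [← Nat.div_add_mod (i : ℕ) B, ← Nat.div_add_mod (j : ℕ) B, hi, hj, hij]

open scoped Classical in
/-- A map into `Fin B` that is balanced on every fibre of `τ`. -/
theorem exists_balanced (τ : X → T) (B : ℕ) (hB : 0 < B) :
    ∃ h : X → Fin B, ∀ t w,
      (Finset.univ.filter (fun x => τ x = t ∧ h x = w)).card
        ≤ (Finset.univ.filter (fun x => τ x = t)).card / B + 1 := by
  have e : ∀ t, {x // τ x = t} ≃ Fin (Finset.univ.filter (fun x => τ x = t)).card :=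
    fun t => Fintype.equivFinOfCardEq (Fintype.card_subtype _)
  -- Number the points of each fibre consecutively and reduce modulo `B`.
  refine ⟨fun x => ⟨(e (τ x) ⟨x, rfl⟩ : ℕ) % B, Nat.mod_lt _ hB⟩, fun t w => ?_⟩
  have hc := card_filter_mod_le (Finset.univ.filter (fun x => τ x = t)).card B w
  refine le_trans ?_ hc
  rw [← Fintype.card_subtype, ← Fintype.card_subtype (fun j : Fin _ => (j : ℕ) % B = w)]
  refine Fintype.card_le_of_injective
    (fun x => ⟨e t ⟨x.1, x.2.1⟩, ?_⟩) ?_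
  · obtain ⟨x, rfl, hx⟩ := x
    simpa [Fin.ext_iff] using hx
  · intro x y hxy
    simpa [Subtype.ext_iff] using (e t).injective (Subtype.mk.inj hxy)

open scoped Classical in
/-- A labelling that separates the points of a set within each fibre of `h`. -/
theorem exists_separating {W G : Type*} [Fintype G] [Nonempty G] (h : X → W) (S : Set X)
    (hS : ∀ w, (Finset.univ.filter (fun x => x ∈ S ∧ h x = w)).card ≤ Fintype.card G) :
    ∃ l : X → G, Set.InjOn (fun x => (l x, h x)) S := by
  have emb : ∀ w, ∃ f : X → G, Set.InjOn f {x | x ∈ S ∧ h x = w} := by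
    intro w
    have h1 : Fintype.card {x // x ∈ S ∧ h x = w} ≤ Fintype.card G := by
      rw [Fintype.card_subtype]; exact hS w
    obtain ⟨f⟩ := Function.Embedding.nonempty_of_card_le h1
    refine ⟨fun x => if hx : x ∈ S ∧ h x = w then f ⟨x, hx⟩ else Classical.arbitrary G, ?_⟩
    intro x hx y hy hxy
    have hx' : x ∈ S ∧ h x = w := hx
    have hy' : y ∈ S ∧ h y = w := hy
    simp only [dif_pos hx', dif_pos hy'] at hxy
    simpa using f.injective hxy
  choose f hf using emb
  refine ⟨fun x => f (h x) x, fun x hx y hy hxy => ?_⟩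
  simp only [Prod.mk.injEq] at hxy
  obtain ⟨h1, h2⟩ := hxy
  exact hf (h x) ⟨hx, rfl⟩ ⟨hy, h2.symm⟩ (by rw [h1, h2])

end Balanced

/-! ### Divergence from the uniform distribution -/

section Divergence

theorem klDivBits_nonneg {W : Type*} [Fintype W] {p q : W → ℝ} (hp : p ∈ stdSimplex ℝ W)
    (hq : ∀ w, 0 < q w) (hq1 : ∑ w, q w = 1) : 0 ≤ klDivBits p q := by
  have hl : 0 < Real.log 2 := Real.log_pos (by norm_num)
  have key : ∀ w, (p w - q w) / Real.log 2 ≤ p w * Real.logb 2 (p w / q w) := by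
    intro w
    rw [Real.logb, ← mul_div_assoc]
    refine div_le_div_of_nonneg_right ?_ hl.le
    rcases (hp.1 w).eq_or_lt with h0 | h0
    · rw [← h0]; simpa using (hq w).le
    · have h1 := Real.one_sub_inv_le_log_of_pos (div_pos h0 (hq w))
      calc p w - q w = p w * (1 - (p w / q w)⁻¹) := by
            have := hq w; field_simp
        _ ≤ _ := mul_le_mul_of_nonneg_left h1 h0.le
  calc (0 : ℝ) = ∑ w, (p w - q w) / Real.log 2 := by
        rw [← Finset.sum_div, Finset.sum_sub_distrib, hp.2, hq1]; simp
    _ ≤ _ := Finset.sum_le_sum fun w _ => key w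

theorem sum_mul_logb_le {W : Type*} [Fintype W] {π : W → ℝ} (hπ : π ∈ stdSimplex ℝ W)
    {B c : ℝ} (hB : 0 < B) (hc : ∀ w, π w * B ≤ c) :
    ∑ w, π w * Real.logb 2 (π w * B) ≤ Real.logb 2 c := by
  calc ∑ w, π w * Real.logb 2 (π w * B) ≤ ∑ w, π w * Real.logb 2 c := by
        refine Finset.sum_le_sum fun w _ => ?_
        rcases (hπ.1 w).eq_or_lt with h0 | h0
        · simp [← h0]
        · exact mul_le_mul_of_nonneg_left
            (Real.logb_le_logb_of_le (by norm_num) (by positivity) (hc w)) h0.le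
    _ = _ := by rw [← Finset.sum_mul, hπ.2, one_mul]

/-- Adding a linear term to `t * log t` keeps it convex. With `B` inside the logarithm, Jensen at
each output point is convexity of the divergence from uniform. -/
theorem convexOn_mul_logb {B : ℝ} (hB : 0 < B) :
    ConvexOn ℝ (Set.Ici 0) (fun t : ℝ => t * Real.logb 2 (t * B)) := by
  have hl : 0 < Real.log 2 := Real.log_pos (by norm_num)
  have h1 : ConvexOn ℝ (Set.Ici 0) (fun t : ℝ => (Real.log 2)⁻¹ * (t * Real.log t)) :=
    Real.convexOn_mul_log.smul (inv_pos.2 hl).le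
  have h2 : ConvexOn ℝ (Set.Ici 0) (fun t : ℝ => (Real.logb 2 B) * t) := by
    refine ⟨convex_Ici 0, fun x _ y _ a b _ _ _ => le_of_eq ?_⟩
    simp only [smul_eq_mul]; ring
  refine (h1.add h2).congr fun t ht => ?_
  rcases (show (0 : ℝ) ≤ t from ht).eq_or_lt with h0 | h0
  · simp [← h0]
  · simp only [Pi.add_apply]
    rw [Real.logb_mul h0.ne' hB.ne', Real.logb, Real.logb]
    field_simp

open scoped Classical in
/-- Divergence from uniformity of the image, under a map `h` that is balanced on the fibres of
`τ`, of a distribution that is constant on these fibres. -/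
theorem sum_image_mul_logb_le {X T : Type*} [Fintype X] (τ : X → T) (b : ℕ)
    (h : X → Fin (2 ^ b))
    (hh : ∀ t w, (Finset.univ.filter (fun x => τ x = t ∧ h x = w)).card
        ≤ (Finset.univ.filter (fun x => τ x = t)).card / 2 ^ b + 1)
    {P : X → ℝ} (hP : P ∈ stdSimplex ℝ X) (hτ : ∀ x y, τ x = τ y → P x = P y)
    {s : ℝ} (hs : 0 < s) :
    ∑ w, (∑ x, if h x = w then P x else 0) *
        Real.logb 2 ((∑ x, if h x = w then P x else 0) * 2 ^ b)
      ≤ b * ((∑ x, if ((Finset.univ.filter (fun y => τ y = τ x)).card : ℝ) < s then P x else 0)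
          + 2 * (2 ^ b / s)) := by
  set N : X → ℝ := fun x => (Finset.univ.filter (fun y => τ y = τ x)).card with hN
  have hNpos : ∀ x, 0 < N x := fun x =>
    Nat.cast_pos.2 (Finset.card_pos.2 ⟨x, by simp⟩)
  -- `π x` is the law of `h` on the uniformly distributed fibre of `x`; the image of `P` is the
  -- mixture of the `π x` with weights `P x`.
  set π : X → Fin (2 ^ b) → ℝ := fun x w =>
    (Finset.univ.filter (fun y => τ y = τ x ∧ h y = w)).card / N x with hπ
  have hπs : ∀ x, π x ∈ stdSimplex ℝ (Fin (2 ^ b)) := by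
    intro x
    refine ⟨fun w => div_nonneg (Nat.cast_nonneg _) (hNpos x).le, ?_⟩
    rw [hπ, ← Finset.sum_div, div_eq_one_iff_eq (hNpos x).ne', hN]
    simp only
    rw [Finset.card_eq_sum_card_fiberwise (f := h) (t := Finset.univ) (fun _ _ => by simp)]
    push_cast
    simp only [Finset.filter_filter]
  have himage : ∀ w, (∑ x, if h x = w then P x else 0) = ∑ x, P x * π x w := by
    intro w
    have e1 : ∀ x, P x * π x w
        = ∑ y, if h y = w then (if τ x = τ y then P y / N y else 0) else 0 := by
      intro x
      simp only [hπ, Finset.card_filter]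
      push_cast
      rw [Finset.sum_div, Finset.mul_sum]
      refine Finset.sum_congr rfl fun y _ => ?_
      by_cases h1 : τ y = τ x
      · have : N y = N x := by simp only [hN, h1]
        by_cases h2 : h y = w
        · simp [h1, h2, hτ x y h1.symm, this, div_eq_mul_inv]
        · simp [h2]
      · simp [h1, Ne.symm h1]
    rw [Finset.sum_congr rfl fun x _ => e1 x, Finset.sum_comm]
    refine Finset.sum_congr rfl fun y _ => ?_
    by_cases h2 : h y = w
    · simp only [h2, if_true]
      rw [← Finset.sum_filter, Finset.sum_const, nsmul_eq_mul]
      have := (hNpos y).ne'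
      change P y = N y * (P y / N y)
      field_simp
    · simp [h2]
  have hBpos : (0 : ℝ) < 2 ^ b := by positivity
  have hconv : ∀ w, (∑ x, P x * π x w) * Real.logb 2 ((∑ x, P x * π x w) * 2 ^ b)
      ≤ ∑ x, P x * (π x w * Real.logb 2 (π x w * 2 ^ b)) := by
    intro w
    have := (convexOn_mul_logb hBpos).map_sum_le (t := Finset.univ) (w := P)
      (p := fun x => π x w) (fun x _ => hP.1 x) hP.2 (fun x _ => (hπs x).1 w)
    simpa only [smul_eq_mul] using this
  have hpt : ∀ x, ∑ w, π x w * Real.logb 2 (π x w * 2 ^ b)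
      ≤ b * ((if N x < s then 1 else 0) + 2 * (2 ^ b / s)) := by
    intro x
    have hb : ∑ w, π x w * Real.logb 2 (π x w * 2 ^ b) ≤ b := by
      refine (sum_mul_logb_le (hπs x) hBpos (c := 2 ^ b) fun w => ?_).trans_eq ?_
      · have : π x w ≤ 1 := by
          rw [← (hπs x).2]
          exact Finset.single_le_sum (fun w _ => (hπs x).1 w) (Finset.mem_univ w)
        nlinarith
      · rw [Real.logb_pow, Real.logb_self_eq_one (by norm_num), mul_one]
    have hq : 0 ≤ 2 * (2 ^ b / s) := by positivity
    by_cases hlt : N x < s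
    · rw [if_pos hlt]
      have : (0 : ℝ) ≤ b := Nat.cast_nonneg b
      nlinarith
    · rw [if_neg hlt, zero_add]
      -- The estimate below lacks the factor `b`, which may be inserted only when `b ≥ 1`; for `b =
      -- 0` the trivial bound suffices.
      rcases Nat.eq_zero_or_pos b with rfl | hb0
      · simpa using hb
      have h1 : ∑ w, π x w * Real.logb 2 (π x w * 2 ^ b) ≤ Real.logb 2 (1 + 2 ^ b / N x) := by
        refine sum_mul_logb_le (hπs x) hBpos fun w => ?_
        have h2 : ((Finset.univ.filter (fun y => τ y = τ x ∧ h y = w)).card : ℝ)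
            ≤ N x / 2 ^ b + 1 := by
          have h3 : ((Finset.univ.filter (fun y => τ y = τ x ∧ h y = w)).card : ℝ)
            ≤ (((Finset.univ.filter (fun y => τ y = τ x)).card / 2 ^ b : ℕ) : ℝ) + 1 := by
            exact_mod_cast hh (τ x) w
          refine h3.trans (add_le_add_left ?_ 1)
          refine Nat.cast_div_le.trans_eq ?_
          push_cast; rfl
        have := hNpos x
        calc π x w * 2 ^ b
            = (Finset.univ.filter (fun y => τ y = τ x ∧ h y = w)).card * (2 ^ b / N x) := by
              simp only [hπ]; ring
          _ ≤ (N x / 2 ^ b + 1) * (2 ^ b / N x) :=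
              mul_le_mul_of_nonneg_right h2 (by positivity)
          _ = _ := by field_simp
      have hε : 2 ^ b / N x ≤ 2 ^ b / s := by
        have := not_lt.1 hlt
        gcongr
      have h0 : 0 ≤ 2 ^ b / N x := by have := hNpos x; positivity
      -- The factor 2 absorbs `1 / log 2`.
      have h4 : Real.logb 2 (1 + 2 ^ b / N x) ≤ 2 * (2 ^ b / N x) := by
        have h5 := Real.log_le_sub_one_of_pos (show 0 < 1 + 2 ^ b / N x by positivity)
        have h6 := Real.log_two_gt_d9
        rw [Real.logb, div_le_iff₀ (by positivity)]
        nlinarith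
      have : (1 : ℝ) ≤ b := by exact_mod_cast hb0
      nlinarith
  calc _ = ∑ w, (∑ x, P x * π x w) * Real.logb 2 ((∑ x, P x * π x w) * 2 ^ b) := by
        simp only [himage]
    _ ≤ ∑ w, ∑ x, P x * (π x w * Real.logb 2 (π x w * 2 ^ b)) :=
        Finset.sum_le_sum fun w _ => hconv w
    _ = ∑ x, P x * ∑ w, π x w * Real.logb 2 (π x w * 2 ^ b) := by
        rw [Finset.sum_comm]; simp only [Finset.mul_sum]
    _ ≤ ∑ x, P x * (b * ((if N x < s then 1 else 0) + 2 * (2 ^ b / s))) :=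
        Finset.sum_le_sum fun x _ => mul_le_mul_of_nonneg_left (hpt x) (hP.1 x)
    _ = _ := by
        have e : ∀ x, P x * (b * ((if N x < s then 1 else 0) + 2 * (2 ^ b / s)))
            = b * ((if N x < s then P x else 0) + P x * (2 * (2 ^ b / s))) := by
          intro x; split_ifs <;> ring
        simp only [e]
        rw [← Finset.mul_sum, Finset.sum_add_distrib, ← Finset.sum_mul, hP.2, one_mul]

end Divergence

/-! ### Hash and masked label as a code -/

section Code

variable {A : Type*} [Fintype A] {n : ℕ}

theorem seqProb_mem_stdSimplex {p : A → ℝ} (hp : p ∈ stdSimplex ℝ A) :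
    (fun x : Fin n → A => seqProb p x) ∈ stdSimplex ℝ (Fin n → A) :=
  ⟨fun x => seqProb_nonneg hp x, sum_seqProb hp⟩

theorem outputDist_mem_stdSimplex {d : ℕ} {p : A → ℝ} (hp : p ∈ stdSimplex ℝ A)
    (c : UniformSourceCode A n d) : c.outputDist p ∈ stdSimplex ℝ (Fin c.len → Bool) := by
  classical
  refine ⟨fun w => ?_, ?_⟩
  · refine Finset.sum_nonneg fun x _ => Finset.sum_nonneg fun u _ => ?_
    have := seqProb_nonneg hp x
    split_ifs <;> positivity
  · unfold UniformSourceCode.outputDist sourceSeedProb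
    rw [Finset.sum_comm]
    rw [← sum_seqProb (n := n) hp]
    refine Finset.sum_congr rfl fun x _ => ?_
    rw [Finset.sum_comm]
    refine (Finset.sum_congr rfl fun u _ => (Finset.sum_eq_single (c.enc x u)
      (fun w _ hw => if_neg hw.symm) (fun h => absurd (Finset.mem_univ _) h)).trans
        (if_pos rfl)).trans ?_
    simp only [Finset.sum_const, Finset.card_univ, Fintype.card_fin, nsmul_eq_mul]
    push_cast
    field_simp

theorem uniformityError_nonneg {d : ℕ} {p : A → ℝ} (hp : p ∈ stdSimplex ℝ A)
    (c : UniformSourceCode A n d) : 0 ≤ c.uniformityError p :=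
  klDivBits_nonneg (outputDist_mem_stdSimplex hp c) (fun _ => by positivity) (by simp)

open scoped Classical in
/-- The code whose output is the pair of `h x` and of `l x` shifted by a part of the seed. -/
theorem exists_padded_code [Nonempty A] {a b d : ℕ} (had : a ≤ d) (l : (Fin n → A) → ZMod (2 ^ a))
    (h : (Fin n → A) → Fin (2 ^ b)) (S : Set (Fin n → A)) :
    ∃ c : UniformSourceCode A n d, c.len = a + b ∧
      (∀ p, c.uniformityError p = ∑ w, (∑ x, if h x = w then seqProb p x else 0) *
        Real.logb 2 ((∑ x, if h x = w then seqProb p x else 0) * 2 ^ b)) ∧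
      (Set.InjOn (fun x => (l x, h x)) S → ∀ x ∈ S, ∀ u, c.DecodesTo (c.output x u) u x) := by
  -- The seed splits into a mask of `a` bits and `d - a` idle bits.
  have e : Fin (2 ^ d) ≃ ZMod (2 ^ a) × Fin (2 ^ (d - a)) :=
    Fintype.equivOfCardEq (by simp [← pow_add, had])
  have E : ZMod (2 ^ a) × Fin (2 ^ b) ≃ (Fin (a + b) → Bool) :=
    Fintype.equivOfCardEq (by simp [← pow_add])
  let c : UniformSourceCode A n d :=
    { len := a + b
      enc := fun x u => E (l x + (e u).1, h x)
      dec := fun w u => Function.invFunOn (fun x => (l x, h x)) S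
        ((E.symm w).1 - (e u).1, (E.symm w).2) }
  refine ⟨c, rfl, fun p => ?_, fun hinj x hx u => ⟨rfl, ?_⟩⟩
  -- For each `x`, exactly `2 ^ (d - a)` seeds carry the label to a given `g`, so the first
  -- component is uniform and independent of `h`.
  · have hout : ∀ g w, c.outputDist p (E (g, w))
        = ((2 : ℝ) ^ a)⁻¹ * ∑ x, if h x = w then seqProb p x else 0 := by
      intro g w
      unfold UniformSourceCode.outputDist sourceSeedProb
      rw [Finset.mul_sum]
      refine Finset.sum_congr rfl fun x _ => ?_
      have h1 : ∀ u, (if c.enc x u = E (g, w) then seqProb p x * ((2 : ℝ) ^ d)⁻¹ else 0)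
          = (fun v : ZMod (2 ^ a) × Fin (2 ^ (d - a)) => if v.1 = g - l x then
            (if h x = w then seqProb p x * ((2 : ℝ) ^ d)⁻¹ else 0) else 0) (e u) := by
        intro u
        have h2 : c.enc x u = E (g, w) ↔ (e u).1 = g - l x ∧ h x = w := by
          simp only [c, EmbeddingLike.apply_eq_iff_eq, Prod.mk.injEq, eq_sub_iff_add_eq']
        simp only [h2, ite_and]
      refine (Finset.sum_congr rfl fun u _ => Eq.trans (by congr) (h1 u)).trans ?_
      rw [Equiv.sum_comp e (fun v : ZMod (2 ^ a) × Fin (2 ^ (d - a)) => if v.1 = g - l x then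
            (if h x = w then seqProb p x * ((2 : ℝ) ^ d)⁻¹ else 0) else 0),
        Fintype.sum_prod_type, Finset.sum_comm]
      simp only [Finset.sum_ite_eq', Finset.mem_univ, if_true, Finset.sum_const,
        Finset.card_univ, Fintype.card_fin, nsmul_eq_mul]
      have h3 : (2 : ℝ) ^ d = 2 ^ (d - a) * 2 ^ a := by rw [← pow_add, Nat.sub_add_cancel had]
      rw [h3]
      split_ifs
      · push_cast; field_simp
      · simp
    unfold UniformSourceCode.uniformityError klDivBits
    have hsum := Equiv.sum_comp E (fun w => c.outputDist p w *
      Real.logb 2 (c.outputDist p w / ((2 : ℝ) ^ c.len)⁻¹))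
    refine hsum.symm.trans ?_
    rw [Fintype.sum_prod_type, Finset.sum_comm]
    refine Finset.sum_congr rfl fun w _ => ?_
    simp only [hout]
    have h4 : (2 : ℝ) ^ c.len = 2 ^ a * 2 ^ b := pow_add _ _ _
    rw [h4, Finset.sum_const, Finset.card_univ, ZMod.card, nsmul_eq_mul]
    generalize (∑ x, if h x = w then seqProb p x else 0) = q
    have h5 : ((2 : ℝ) ^ a)⁻¹ * q / (2 ^ a * 2 ^ b)⁻¹ = q * 2 ^ b := by field_simp
    rw [h5]
    push_cast
    field_simp
  · change Function.invFunOn (fun x => (l x, h x)) S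
        ((E.symm (E (l x + (e u).1, h x))).1 - (e u).1, (E.symm (E (l x + (e u).1, h x))).2) = x
    simp only [Equiv.symm_apply_apply, add_sub_cancel_right]
    exact hinj.leftInvOn_invFunOn hx


open scoped Classical in
-- The hash is balanced on type classes, and `S` is the set to be decoded. If classes meeting `S`
-- have at most `2 ^ (b + e)` elements, each puts at most `2 ^ e + 1` points in a fibre of `h`;
-- multiplying by the number of types bounds the labels needed. One code serves all `p`, with `s`
-- left free for the analysis.
theorem exists_universal_code [Nonempty A] (n : ℕ) {a d : ℕ} (had : a ≤ d) (b e : ℕ)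
    (S : Set (Fin n → A)) :
    ∃ c : UniformSourceCode A n d, c.len = a + b ∧
      (∀ p ∈ stdSimplex ℝ A, ∀ s : ℝ, 0 < s → c.uniformityError p
        ≤ b * (sourceProb p (fun x : Fin n → A => (typeCard x : ℝ) < s) + 2 * (2 ^ b / s))) ∧
      ((∀ x ∈ S, typeCard x ≤ 2 ^ (b + e)) →
        (n + 1) ^ Fintype.card A * (2 ^ e + 1) ≤ 2 ^ a →
        ∀ x ∈ S, ∀ u, c.DecodesTo (c.output x u) u x) := by
  obtain ⟨h, hh⟩ := exists_balanced (letterCounts (A := A) (n := n)) (2 ^ b) (by positivity)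
  have hl : ∃ l : (Fin n → A) → ZMod (2 ^ a), (∀ x ∈ S, typeCard x ≤ 2 ^ (b + e)) →
        (n + 1) ^ Fintype.card A * (2 ^ e + 1) ≤ 2 ^ a → Set.InjOn (fun x => (l x, h x)) S := by
    -- Length and uniformity must hold even when there are too few labels; then any labelling will
    -- do.
    by_cases hc : (∀ x ∈ S, typeCard x ≤ 2 ^ (b + e)) ∧
        (n + 1) ^ Fintype.card A * (2 ^ e + 1) ≤ 2 ^ a
    · obtain ⟨hS, ha⟩ := hc
      obtain ⟨l, hl⟩ := exists_separating (G := ZMod (2 ^ a)) h S (by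
        intro w
        rw [ZMod.card]
        refine le_trans ?_ ha
        rw [Finset.card_eq_sum_card_fiberwise (f := letterCounts) (t := Finset.univ)
          (fun _ _ => by simp)]
        have hT : (n + 1) ^ Fintype.card A * (2 ^ e + 1)
            = ∑ t : A → Fin (n + 1), (2 ^ e + 1) := by simp
        rw [hT]
        refine Finset.sum_le_sum fun t _ => ?_
        rw [Finset.filter_filter]
        by_cases ht : ∃ x ∈ S, letterCounts x = t
        · obtain ⟨x, hx, rfl⟩ := ht
          refine (Finset.card_le_card ?_).trans ((hh (letterCounts x) w).trans ?_)
          · intro y; simp only [Finset.mem_filter]; tauto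
          · refine Nat.add_le_add_right ?_ 1
            refine Nat.div_le_of_le_mul ?_
            rw [← pow_add]
            have := hS x hx
            unfold typeCard at this
            convert this
        · rw [Finset.card_eq_zero.2]
          · exact Nat.zero_le _
          · refine Finset.eq_empty_of_forall_notMem fun x hx => ?_
            simp only [Finset.mem_filter] at hx
            exact ht ⟨x, hx.2.1.1, hx.2.2⟩)
      exact ⟨l, fun _ _ => hl⟩
    · exact ⟨fun _ => 0, fun h1 h2 => absurd ⟨h1, h2⟩ hc⟩
  obtain ⟨l, hl⟩ := hl
  obtain ⟨c, hlen, hU, hD⟩ := exists_padded_code had l h S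
  refine ⟨c, hlen, fun p hp s hs => ?_, fun h1 h2 => hD (hl h1 h2)⟩
  rw [hU]
  refine (sum_image_mul_logb_le letterCounts b h hh (P := fun x => seqProb p x)
    (seqProb_mem_stdSimplex hp) (fun x y hxy => seqProb_congr p hxy) hs).trans_eq ?_
  unfold sourceProb typeCard
  congr!

end Code

/-! ### Probability bounds for the source -/

section SourceProb

theorem letterCounts_sub_eq_sum {A : Type*} [DecidableEq A] {n : ℕ} (x : Fin n → A) (a : A)
    (c : ℝ) :
    ((letterCounts x a : ℕ) : ℝ) - n * c = ∑ i, ((if x i = a then 1 else 0) - c) := by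
  rw [Finset.sum_sub_distrib, Finset.sum_boole]
  simp only [Finset.sum_const, Finset.card_univ, Fintype.card_fin, nsmul_eq_mul]
  congr 2
  simp only [letterCounts]
  congr

variable {A : Type*} [Fintype A] {n : ℕ} {p : A → ℝ}

theorem sourceProb_nonneg (hp : p ∈ stdSimplex ℝ A) (E : (Fin n → A) → Prop) :
    0 ≤ sourceProb p E :=
  Finset.sum_nonneg fun x _ => by
    have := seqProb_nonneg hp x
    split_ifs <;> simp [this]

theorem sourceProb_le_of_pos (hp : p ∈ stdSimplex ℝ A) {E F : (Fin n → A) → Prop}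
    (h : ∀ x, 0 < seqProb p x → E x → F x) : sourceProb p E ≤ sourceProb p F := by
  refine Finset.sum_le_sum fun x _ => ?_
  rcases (seqProb_nonneg hp x).eq_or_lt with h0 | h0
  · simp [← h0]
  · by_cases hE : E x
    · simp [hE, h x h0 hE]
    · rw [if_neg hE]; split_ifs <;> simp [h0.le]

theorem sourceProb_mono (hp : p ∈ stdSimplex ℝ A) {E F : (Fin n → A) → Prop}
    (h : ∀ x, E x → F x) : sourceProb p E ≤ sourceProb p F :=
  sourceProb_le_of_pos hp fun x _ => h x

theorem sourceProb_or_le (hp : p ∈ stdSimplex ℝ A) (E F : (Fin n → A) → Prop) :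
    sourceProb p (fun x => E x ∨ F x) ≤ sourceProb p E + sourceProb p F := by
  unfold sourceProb
  rw [← Finset.sum_add_distrib]
  refine Finset.sum_le_sum fun x _ => ?_
  have := seqProb_nonneg hp x
  by_cases hE : E x <;> by_cases hF : F x <;> simp [hE, hF, this]

theorem sourceProb_exists_le {ι : Type*} [Fintype ι] (hp : p ∈ stdSimplex ℝ A)
    (E : ι → (Fin n → A) → Prop) :
    sourceProb p (fun x => ∃ i, E i x) ≤ ∑ i, sourceProb p (E i) := by
  classical
  unfold sourceProb
  rw [Finset.sum_comm]
  refine Finset.sum_le_sum fun x _ => ?_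
  have hx := seqProb_nonneg hp x
  split_ifs with h
  · obtain ⟨i, hi⟩ := h
    refine le_trans ?_ (Finset.single_le_sum (fun i _ => ?_) (Finset.mem_univ i))
    · rw [if_pos hi]
    · split_ifs <;> simp [hx]
  · refine Finset.sum_nonneg fun i _ => ?_
    split_ifs <;> simp [hx]

theorem sourceProb_add_not (hp : p ∈ stdSimplex ℝ A) (E : (Fin n → A) → Prop) :
    sourceProb p E + sourceProb p (fun x => ¬ E x) = 1 := by
  rw [← sum_seqProb (n := n) hp]
  unfold sourceProb
  rw [← Finset.sum_add_distrib]
  refine Finset.sum_congr rfl fun x _ => ?_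
  by_cases hE : E x <;> simp [hE]

/-- Chernoff bound for the empirical mean of a centred function of the letters. -/
theorem sourceProb_lt_sum_le (hp : p ∈ stdSimplex ℝ A) {g : A → ℝ} (hg : ∀ a, |g a| ≤ 1)
    (hmean : ∑ a, p a * g a = 0) {l t : ℝ} (hl : 0 ≤ l) (hl1 : l ≤ 1) :
    sourceProb p (fun x : Fin n → A => t < ∑ i, g (x i)) ≤ Real.exp (n * l ^ 2 - l * t) := by
  have hmgf : ∑ a, p a * Real.exp (l * g a) ≤ Real.exp (l ^ 2) := by
    calc ∑ a, p a * Real.exp (l * g a) ≤ ∑ a, (p a + l * (p a * g a) + p a * l ^ 2) := by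
          refine Finset.sum_le_sum fun a _ => ?_
          have h1 : |l * g a| ≤ 1 := by
            rw [abs_mul, abs_of_nonneg hl]; exact mul_le_one₀ hl1 (abs_nonneg _) (hg a)
          -- `exp y ≤ 1 + y + y ^ 2` for `|y| ≤ 1`; the linear term averages to zero.
          have h2 := (abs_le.1 (Real.abs_exp_sub_one_sub_id_le h1)).2
          have h3 : (l * g a) ^ 2 ≤ l ^ 2 := by
            rw [mul_pow]
            have : g a ^ 2 ≤ 1 := by rw [← sq_abs]; exact pow_le_one₀ (abs_nonneg _) (hg a)
            nlinarith [sq_nonneg l]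
          have := hp.1 a
          nlinarith
      _ = 1 + l ^ 2 := by
          rw [Finset.sum_add_distrib, Finset.sum_add_distrib, ← Finset.mul_sum, ← Finset.sum_mul,
            hp.2, hmean]; ring
      _ ≤ _ := by have := Real.add_one_le_exp (l ^ 2); linarith
  have hnn : 0 ≤ ∑ a, p a * Real.exp (l * g a) :=
    Finset.sum_nonneg fun a _ => mul_nonneg (hp.1 a) (Real.exp_pos _).le
  calc sourceProb p (fun x : Fin n → A => t < ∑ i, g (x i))
      ≤ ∑ x : Fin n → A, Real.exp (-(l * t)) * (seqProb p x * ∏ i, Real.exp (l * g (x i))) := by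
        refine Finset.sum_le_sum fun x _ => ?_
        have hx := seqProb_nonneg hp x
        rw [← Real.exp_sum, ← Finset.mul_sum, mul_left_comm, ← Real.exp_add]
        split_ifs with h
        · refine le_mul_of_one_le_right hx (Real.one_le_exp ?_)
          nlinarith
        · positivity
    _ = Real.exp (-(l * t)) * (∑ a, p a * Real.exp (l * g a)) ^ n := by
        rw [← Finset.mul_sum, sum_seqProb_mul_prod p (fun a => Real.exp (l * g a))]
    _ ≤ Real.exp (-(l * t)) * Real.exp (l ^ 2) ^ n := by gcongr
    _ = _ := by rw [← Real.exp_nat_mul, ← Real.exp_add]; ring_nf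

/-- Chernoff on both sides with parameter `1 / √n`, for which the quadratic term costs only a factor
`exp 1`. The tail is exponential in `θ / √n`, enough for `θ` of order `n ^ (1 / 2 + γ)`. -/
theorem sourceProb_letterCounts_le (hp : p ∈ stdSimplex ℝ A) (hn : 0 < n) (a : A) (θ : ℝ) :
    sourceProb p (fun x : Fin n → A => θ < |((letterCounts x a : ℕ) : ℝ) - n * p a|)
      ≤ 2 * Real.exp 1 * Real.exp (-(θ / √n)) := by
  classical
  have hpa : p a ≤ 1 := by
    rw [← hp.2]; exact Finset.single_le_sum (fun a _ => hp.1 a) (Finset.mem_univ a)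
  have hpa0 := hp.1 a
  have hs : 0 < √(n : ℝ) := Real.sqrt_pos.2 (by exact_mod_cast hn)
  have hs1 : 1 ≤ √(n : ℝ) := Real.one_le_sqrt.2 (by exact_mod_cast hn)
  have hl1 : (√(n : ℝ))⁻¹ ≤ 1 := inv_le_one_of_one_le₀ hs1
  have hexp : ∀ t : ℝ, Real.exp (n * (√(n : ℝ))⁻¹ ^ 2 - (√(n : ℝ))⁻¹ * t)
      = Real.exp 1 * Real.exp (-(t / √n)) := by
    intro t
    rw [← Real.exp_add, inv_pow, Real.sq_sqrt (Nat.cast_nonneg n), mul_inv_cancel₀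
      (by exact_mod_cast hn.ne')]
    congr 1; ring
  set g : A → ℝ := fun c => (if c = a then 1 else 0) - p a with hgdef
  have hg : ∀ c, |g c| ≤ 1 := by
    intro c; rw [abs_le]; simp only [g]; split_ifs <;> constructor <;> linarith
  have hmean : ∑ c, p c * g c = 0 := by
    simp [g, mul_sub, Finset.sum_sub_distrib, ← Finset.sum_mul, hp.2]
  have h1 := sourceProb_lt_sum_le (n := n) hp hg hmean (t := θ) (inv_pos.2 hs).le hl1
  have h2 := sourceProb_lt_sum_le (n := n) hp (g := fun c => -g c) (by simpa using hg)
    (by simpa using hmean) (t := θ) (inv_pos.2 hs).le hl1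
  rw [hexp] at h1 h2
  refine (sourceProb_mono hp (F := fun x => (θ < ∑ i, g (x i)) ∨ θ < ∑ i, -g (x i)) ?_).trans
    ((sourceProb_or_le hp _ _).trans (by linarith))
  intro x hx
  rw [letterCounts_sub_eq_sum] at hx
  rw [Finset.sum_neg_distrib]
  exact lt_abs.1 hx

/-- A class with fewer than `s` members, each of probability at most `q`, has mass at most `s * q`,
and there are at most `(n + 1) ^ |A|` classes. -/
theorem sourceProb_typeCard_lt_le (hp : p ∈ stdSimplex ℝ A) {s q : ℝ} (hs : 0 ≤ s) (hq : 0 ≤ q) :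
    sourceProb p (fun x : Fin n → A => (typeCard x : ℝ) < s)
      ≤ sourceProb p (fun x : Fin n → A => q < seqProb p x)
        + (n + 1) ^ Fintype.card A * (s * q) := by
  classical
  have h1 : sourceProb p (fun x : Fin n → A => (typeCard x : ℝ) < s ∧ seqProb p x ≤ q)
      ≤ (n + 1) ^ Fintype.card A * (s * q) := by
    unfold sourceProb
    rw [← Finset.sum_fiberwise (g := letterCounts)]
    have hT : ((n : ℝ) + 1) ^ Fintype.card A * (s * q)
        = ∑ t : A → Fin (n + 1), s * q := by simp
    rw [hT]
    refine Finset.sum_le_sum fun t _ => ?_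
    by_cases ht : ∃ x : Fin n → A, letterCounts x = t ∧ (typeCard x : ℝ) < s
    · obtain ⟨x, rfl, hx⟩ := ht
      calc _ ≤ ∑ y ∈ Finset.univ.filter (fun y => letterCounts y = letterCounts x), q := by
            refine Finset.sum_le_sum fun y _ => ?_
            split_ifs with h
            exacts [h.2, hq]
        _ = typeCard x * q := by
            rw [Finset.sum_const, nsmul_eq_mul]
            unfold typeCard; congr!
        _ ≤ s * q := mul_le_mul_of_nonneg_right hx.le hq
    · refine (Finset.sum_eq_zero fun y hy => if_neg fun h => ht ⟨y, ?_, h.1⟩).trans_le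
        (mul_nonneg hs hq)
      simpa using hy
  refine (sourceProb_mono hp (F := fun x => q < seqProb p x ∨
    ((typeCard x : ℝ) < s ∧ seqProb p x ≤ q)) fun x hx => ?_).trans
    ((sourceProb_or_le hp _ _).trans (by linarith))
  rcases lt_or_ge q (seqProb p x) with h | h
  exacts [Or.inl h, Or.inr ⟨hx, h⟩]

end SourceProb

/-! ### Typical sequences -/

section Typicality

variable {A : Type*} [Fintype A] {p : A → ℝ}

/-- Differentiability gives a local Lipschitz bound at `c ≠ 0`. The slope is infinite at 0, but a
letter of probability 0 does not occur in a sequence of positive probability, whence the condition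
on `t`. -/
theorem exists_abs_negMulLog_sub_le (c : ℝ) :
    ∃ C δ : ℝ, 0 ≤ C ∧ 0 < δ ∧ ∀ t, |t - c| ≤ δ → (c = 0 → t = 0) →
      |Real.negMulLog t - Real.negMulLog c| ≤ C * |t - c| := by
  rcases eq_or_ne c 0 with rfl | hc
  · exact ⟨0, 1, le_rfl, one_pos, fun t _ h => by simp [h rfl]⟩
  · obtain ⟨C, hC, hO⟩ := (Real.hasDerivAt_negMulLog hc).differentiableAt.isBigO_sub.exists_nonneg
    obtain ⟨δ, hδ, h⟩ := Metric.eventually_nhds_iff.1 hO.bound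
    refine ⟨C, δ / 2, hC, by positivity, fun t ht _ => ?_⟩
    have := h (y := t) (by rw [Real.dist_eq]; linarith)
    simpa only [Real.norm_eq_abs] using this

theorem letterCounts_eq_zero_of_seqProb_pos {n : ℕ} {x : Fin n → A} (hx : 0 < seqProb p x) {a : A}
    (ha : p a = 0) : (letterCounts x a : ℕ) = 0 := by
  by_contra h
  refine hx.ne' ?_
  rw [seqProb_eq_prod_pow]
  exact Finset.prod_eq_zero (Finset.mem_univ a) (by rw [ha, zero_pow h])

theorem seqProb_eq_exp {n : ℕ} {x : Fin n → A} (hp : p ∈ stdSimplex ℝ A) (hx : 0 < seqProb p x) :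
    seqProb p x = Real.exp (∑ a, ((letterCounts x a : ℕ) : ℝ) * Real.log (p a)) := by
  rw [Real.exp_sum, seqProb_eq_prod_pow]
  refine Finset.prod_congr rfl fun a _ => ?_
  rcases (hp.1 a).eq_or_lt with h0 | h0
  · simp [letterCounts_eq_zero_of_seqProb_pos hx h0.symm]
  · rw [Real.exp_nat_mul, Real.exp_log h0]

/-- When the letter counts deviate from their means by at most `θ`, the probability of the sequence
and the plug-in entropy deviate from their typical values by a multiple of `θ`. -/
theorem exists_typicality_const [Nonempty A] (hp : p ∈ stdSimplex ℝ A) :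
    ∃ C δ : ℝ, 0 < C ∧ 0 < δ ∧ ∀ (n : ℕ) (x : Fin n → A) (θ : ℝ), 0 < n → θ ≤ δ * n →
      0 < seqProb p x → (∀ a, |((letterCounts x a : ℕ) : ℝ) - n * p a| ≤ θ) →
      |n * plugInEntropy x - n * shannonEntropy p| ≤ C * θ ∧
      seqProb p x ≤ (2 : ℝ) ^ (-(n * shannonEntropy p) + C * θ) := by
  choose C δ hC hδ hL using fun a => exists_abs_negMulLog_sub_le (p a)
  have hl : 0 < Real.log 2 := Real.log_pos (by norm_num)
  set C₁ : ℝ := (∑ a, C a) / Real.log 2 with hC₁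
  set C₂ : ℝ := (∑ a, |Real.log (p a)|) / Real.log 2 with hC₂
  have hC₁0 : 0 ≤ C₁ := div_nonneg (Finset.sum_nonneg fun a _ => hC a) hl.le
  have hC₂0 : 0 ≤ C₂ := div_nonneg (Finset.sum_nonneg fun a _ => abs_nonneg _) hl.le
  refine ⟨C₁ + C₂ + 1, Finset.univ.inf' Finset.univ_nonempty δ, by positivity,
    (Finset.lt_inf'_iff _).2 fun a _ => hδ a, fun n x θ hn hθ hx hdev => ?_⟩
  have hn' : (0 : ℝ) < n := by exact_mod_cast hn
  have hθ0 : 0 ≤ θ := (abs_nonneg _).trans (hdev (Classical.arbitrary A))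
  constructor
  · have h1 : ∀ a, n * |Real.negMulLog (empiricalDist x a) - Real.negMulLog (p a)| ≤ C a * θ := by
      intro a
      have hd : n * |empiricalDist x a - p a| ≤ θ := by
        refine le_trans (le_of_eq ?_) (hdev a)
        rw [← abs_of_pos hn', ← abs_mul, empiricalDist_eq, abs_of_pos hn']
        congr 1; field_simp
      have hδ' : |empiricalDist x a - p a| ≤ δ a := by
        have h2 : Finset.univ.inf' Finset.univ_nonempty δ ≤ δ a :=
          Finset.inf'_le _ (Finset.mem_univ a)
        by_contra h
        have := mul_lt_mul_of_pos_left (not_le.1 h) hn'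
        nlinarith
      have h3 := hL a _ hδ' (fun h0 => by
        rw [empiricalDist_eq, letterCounts_eq_zero_of_seqProb_pos hx h0]; simp)
      calc _ ≤ n * (C a * |empiricalDist x a - p a|) := mul_le_mul_of_nonneg_left h3 hn'.le
        _ = C a * (n * |empiricalDist x a - p a|) := by ring
        _ ≤ _ := mul_le_mul_of_nonneg_left hd (hC a)
    have h2 : |n * plugInEntropy x - n * shannonEntropy p| ≤ C₁ * θ := by
      unfold plugInEntropy shannonEntropy
      rw [← mul_sub, ← Finset.sum_sub_distrib, abs_mul, abs_of_pos hn']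
      calc _ ≤ n * ∑ a, |Real.negMulLog (empiricalDist x a) / Real.log 2
              - Real.negMulLog (p a) / Real.log 2| :=
            mul_le_mul_of_nonneg_left (Finset.abs_sum_le_sum_abs _ _) hn'.le
        _ = ∑ a, (n * |Real.negMulLog (empiricalDist x a) - Real.negMulLog (p a)|)
              / Real.log 2 := by
            rw [Finset.mul_sum]
            refine Finset.sum_congr rfl fun a _ => ?_
            rw [← sub_div, abs_div, abs_of_pos hl, mul_div_assoc]
        _ ≤ ∑ a, C a * θ / Real.log 2 :=
            Finset.sum_le_sum fun a _ => div_le_div_of_nonneg_right (h1 a) hl.le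
        _ = _ := by rw [← Finset.sum_div, ← Finset.sum_mul]; ring
    nlinarith
  · rw [seqProb_eq_exp hp hx, Real.rpow_def_of_pos (by norm_num)]
    refine Real.exp_le_exp.2 ?_
    have h1 : ∀ a, ((letterCounts x a : ℕ) : ℝ) * Real.log (p a)
        ≤ n * -Real.negMulLog (p a) + θ * |Real.log (p a)| := by
      intro a
      have h2 : (((letterCounts x a : ℕ) : ℝ) - n * p a) * Real.log (p a)
          ≤ θ * |Real.log (p a)| := by
        refine (le_abs_self _).trans ?_
        rw [abs_mul]
        exact mul_le_mul_of_nonneg_right (hdev a) (abs_nonneg _)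
      rw [Real.negMulLog]; linarith
    refine (Finset.sum_le_sum fun a _ => h1 a).trans ?_
    rw [Finset.sum_add_distrib, ← Finset.mul_sum, ← Finset.mul_sum, Finset.sum_neg_distrib]
    have h3 : Real.log 2 * shannonEntropy p = ∑ a, Real.negMulLog (p a) := by
      unfold shannonEntropy
      rw [← Finset.sum_div]; field_simp
    have h4 : Real.log 2 * C₂ = ∑ a, |Real.log (p a)| := by rw [hC₂]; field_simp
    rw [← h3, ← h4]
    have : 0 ≤ Real.log 2 * (C₁ * θ + θ) := by positivity
    linarith

/-- The sequence has nearly its typical probability and plug-in entropy, up to `η` bits. -/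
def IsNearlyTypical {n : ℕ} (p : A → ℝ) (η : ℝ) (x : Fin n → A) : Prop :=
  |n * plugInEntropy x - n * shannonEntropy p| ≤ η ∧
    seqProb p x ≤ (2 : ℝ) ^ (-(n * shannonEntropy p) + η)

theorem exists_sourceProb_not_isNearlyTypical_le [Nonempty A] (hp : p ∈ stdSimplex ℝ A) :
    ∃ C δ K : ℝ, 0 < C ∧ 0 < δ ∧ 0 < K ∧ ∀ (n : ℕ) (θ : ℝ), 0 < n → θ ≤ δ * n →
      sourceProb p (fun x : Fin n → A => ¬ IsNearlyTypical p (C * θ) x)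
        ≤ K * Real.exp (-(θ / √n)) := by
  obtain ⟨C, δ, hC, hδ, h⟩ := exists_typicality_const hp
  refine ⟨C, δ, Fintype.card A * (2 * Real.exp 1), hC, hδ, ?_, fun n θ hn hθ => ?_⟩
  · have : 0 < Fintype.card A := Fintype.card_pos
    positivity
  refine (sourceProb_le_of_pos hp (F := fun x => ∃ a,
    θ < |((letterCounts x a : ℕ) : ℝ) - n * p a|) fun x hx hnot => ?_).trans
    ((sourceProb_exists_le hp _).trans
      ((Finset.sum_le_sum fun a _ => sourceProb_letterCounts_le hp hn a θ).trans_eq ?_))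
  · by_contra hall
    push Not at hall
    exact hnot (h n x θ hn hθ hx hall)
  · rw [Finset.sum_const, Finset.card_univ, nsmul_eq_mul]; ring

end Typicality

/-! ### Converse by counting messages -/

section Converse

variable {A : Type*} [Fintype A] {n d : ℕ} {p : A → ℝ}

/-- The probability that a code with fewer than `L` output bits is selected: unless the decoder errs
or the source emits a sequence of probability above `q`, the sequence is one of at most `2 ^ L`. -/
theorem AdaptiveCode.sourceProb_len_lt_le (hp : p ∈ stdSimplex ℝ A) (C : AdaptiveCode A n d)
    (L : ℕ) {q : ℝ} (hq : 0 ≤ q) :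
    sourceProb p (fun x => (C.encSel x).len < L)
      ≤ C.errorProb p + sourceProb p (fun x : Fin n → A => q < seqProb p x) + 2 ^ L * q := by
  classical
  set Err : (Fin n → A) → Fin (2 ^ d) → Prop := fun x u =>
    ¬ (C.decSel (C.message x u)).DecodesTo (C.message x u) u x with hErr
  -- For a fixed seed, sequences decoded without error have distinct messages, and fewer than `2 ^
  -- L` binary sequences are shorter than `L`.
  have hcount : ∀ u, (Finset.univ.filter
      (fun x => (C.encSel x).len < L ∧ ¬ Err x u)).card ≤ 2 ^ L := by
    intro u
    have hinj : ∀ x y, ¬ Err x u → ¬ Err y u → C.message x u = C.message y u → x = y := by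
      intro x y hx hy hxy
      simp only [hErr, not_not] at hx hy
      rw [hxy] at hx
      obtain ⟨h1, h2⟩ := hx
      obtain ⟨h3, h4⟩ := hy
      exact h2.symm.trans h4
    have hcard : Fintype.card (Σ m : Fin L, (Fin m → Bool)) ≤ 2 ^ L := by
      rw [Fintype.card_sigma]
      simp only [Fintype.card_fun, Fintype.card_bool, Fintype.card_fin]
      rw [Fin.sum_univ_eq_sum_range (fun m => 2 ^ m) L]
      have := Nat.geomSum_lt (m := 2) (n := L) (s := Finset.range L) le_rfl (by simp)
      exact this.le
    refine le_trans ?_ hcard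
    rw [← Fintype.card_subtype]
    refine Fintype.card_le_of_injective
      (fun x => ⟨⟨(C.encSel x.1).len, x.2.1⟩, (C.encSel x.1).enc x.1 u⟩) fun x y hxy => ?_
    refine Subtype.ext (hinj x.1 y.1 x.2.2 y.2.2 ?_)
    have hmap := congrArg (fun z : (Σ m : Fin L, (Fin m → Bool)) => (⟨z.1, z.2⟩ : BitString)) hxy
    exact hmap
  have hterm : ∀ (x : Fin n → A) (u : Fin (2 ^ d)),
      (if (C.encSel x).len < L then seqProb p x else 0) * ((2 : ℝ) ^ d)⁻¹
      ≤ (if Err x u then seqProb p x * ((2 : ℝ) ^ d)⁻¹ else 0)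
        + (if q < seqProb p x then seqProb p x else 0) * ((2 : ℝ) ^ d)⁻¹
        + (if (C.encSel x).len < L ∧ ¬ Err x u then q else 0) * ((2 : ℝ) ^ d)⁻¹ := by
    intro x u
    have hx := seqProb_nonneg hp x
    have h2 : (0 : ℝ) < ((2 : ℝ) ^ d)⁻¹ := by positivity
    have h3 : 0 ≤ seqProb p x * ((2 : ℝ) ^ d)⁻¹ := by positivity
    have h4 : 0 ≤ q * ((2 : ℝ) ^ d)⁻¹ := by positivity
    by_cases hL : (C.encSel x).len < L <;> by_cases hE : Err x u <;>
      by_cases hQ : q < seqProb p x <;> simp only [hL, hE, hQ, if_true, if_false, not_true,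
        not_false_iff, and_self, and_true, and_false, zero_mul] <;> try linarith
    have := mul_le_mul_of_nonneg_right (not_lt.1 hQ) h2.le
    linarith
  have havg : ∀ f : (Fin n → A) → ℝ,
      ∑ x : Fin n → A, ∑ _u : Fin (2 ^ d), f x * ((2 : ℝ) ^ d)⁻¹ = ∑ x, f x := by
    intro f
    refine Finset.sum_congr rfl fun x _ => ?_
    rw [Finset.sum_const, Finset.card_univ, Fintype.card_fin, nsmul_eq_mul]
    push_cast; field_simp
  have hlast : ∑ x : Fin n → A, ∑ u : Fin (2 ^ d),
      (if (C.encSel x).len < L ∧ ¬ Err x u then q else 0) * ((2 : ℝ) ^ d)⁻¹ ≤ 2 ^ L * q := by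
    rw [Finset.sum_comm]
    calc _ ≤ ∑ _u : Fin (2 ^ d), (2 ^ L * q) * ((2 : ℝ) ^ d)⁻¹ := by
          refine Finset.sum_le_sum fun u _ => ?_
          rw [← Finset.sum_mul, ← Finset.sum_filter, Finset.sum_const, nsmul_eq_mul]
          have : ((Finset.univ.filter
            (fun x => (C.encSel x).len < L ∧ ¬ Err x u)).card : ℝ) ≤ 2 ^ L := by
            exact_mod_cast hcount u
          gcongr
      _ = _ := by
          rw [Finset.sum_const, Finset.card_univ, Fintype.card_fin, nsmul_eq_mul]
          push_cast; field_simp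
  have hsum := Finset.sum_le_sum fun x (_ : x ∈ (Finset.univ : Finset (Fin n → A))) =>
    Finset.sum_le_sum fun u (_ : u ∈ (Finset.univ : Finset (Fin (2 ^ d)))) => hterm x u
  simp only [Finset.sum_add_distrib] at hsum
  rw [havg, havg] at hsum
  refine (le_of_eq ?_).trans (hsum.trans (add_le_add (le_of_eq ?_) hlast))
  · unfold sourceProb; congr!
  · unfold AdaptiveCode.errorProb sourceSeedProb sourceProb; congr!

end Converse

/-! ### Growth comparisons -/

section Asymptotics

theorem tendsto_natCast_rpow_atTop {γ : ℝ} (hγ : 0 < γ) :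
    Tendsto (fun n : ℕ => (n : ℝ) ^ γ) atTop atTop :=
  (tendsto_rpow_atTop hγ).comp tendsto_natCast_atTop_atTop

theorem eventually_pow_mul_exp_le (K : ℝ) (j : ℕ) {γ : ℝ} (hγ : 0 < γ) (r : ℝ) :
    ∀ᶠ n : ℕ in atTop, K * n ^ j * Real.exp (-(n : ℝ) ^ γ) ≤ (n : ℝ) ^ (-r) := by
  have h1 := (isLittleO_exp_neg_mul_rpow_atTop one_pos (-((r + j) / γ))).comp_tendsto
    (tendsto_natCast_rpow_atTop hγ)
  have hK : 0 < (|K| + 1)⁻¹ := by positivity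
  filter_upwards [h1.def hK, eventually_gt_atTop 0] with n hn hpos
  have hn0 : (0 : ℝ) < n := by exact_mod_cast hpos
  simp only [Function.comp, neg_mul, one_mul, Real.norm_eq_abs, Real.abs_exp] at hn
  rw [← Real.rpow_mul hn0.le, show γ * -((r + j) / γ) = -r + -(j : ℝ) by field_simp; ring,
    Real.rpow_add hn0, Real.rpow_neg hn0.le (j : ℝ), Real.rpow_natCast,
    abs_of_pos (show 0 < (n : ℝ) ^ (-r) * ((n : ℝ) ^ j)⁻¹ by positivity)] at hn
  have hj : (0 : ℝ) < (n : ℝ) ^ j := by positivity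
  calc K * n ^ j * Real.exp (-(n : ℝ) ^ γ)
      ≤ (|K| + 1) * n ^ j * Real.exp (-(n : ℝ) ^ γ) := by
        gcongr; linarith [le_abs_self K]
    _ ≤ (|K| + 1) * n ^ j * ((|K| + 1)⁻¹ * ((n : ℝ) ^ (-r) * ((n : ℝ) ^ j)⁻¹)) := by gcongr
    _ = (n : ℝ) ^ (-r) := by
        have : |K| + 1 ≠ 0 := by positivity
        field_simp

theorem eventually_mul_rpow_le_rpow (K : ℝ) {s t : ℝ} (hst : s < t) :
    ∀ᶠ n : ℕ in atTop, K * (n : ℝ) ^ s ≤ (n : ℝ) ^ t := by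
  filter_upwards [(tendsto_natCast_rpow_atTop (sub_pos.2 hst)).eventually_ge_atTop K,
    eventually_gt_atTop 0] with n hn hpos
  have hn0 : (0 : ℝ) < n := by exact_mod_cast hpos
  calc K * (n : ℝ) ^ s ≤ (n : ℝ) ^ (t - s) * (n : ℝ) ^ s := by gcongr
    _ = _ := by rw [← Real.rpow_add hn0]; ring_nf

theorem eventually_mul_rpow_le_floor (K : ℝ) {s t : ℝ} (hs : 0 ≤ s) (hst : s < t) :
    ∀ᶠ n : ℕ in atTop, K * (n : ℝ) ^ s ≤ (⌊(n : ℝ) ^ t⌋₊ : ℝ) := by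
  filter_upwards [eventually_mul_rpow_le_rpow (K + 1) hst, eventually_gt_atTop 0] with n hn hpos
  have h1 : (1 : ℝ) ≤ (n : ℝ) ^ s := Real.one_le_rpow (by exact_mod_cast hpos) hs
  have h2 := Nat.lt_floor_add_one ((n : ℝ) ^ t)
  linarith

theorem tendsto_natCast_rpow_div {t : ℝ} (ht : t < 1) :
    Tendsto (fun n : ℕ => (n : ℝ) ^ t / n) atTop (𝓝 0) := by
  have h : Tendsto (fun n : ℕ => (n : ℝ) ^ (-(1 - t))) atTop (𝓝 0) :=
    (tendsto_rpow_neg_atTop (sub_pos.2 ht)).comp tendsto_natCast_atTop_atTop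
  refine h.congr' ?_
  filter_upwards [eventually_gt_atTop 0] with n hpos
  have hn0 : (0 : ℝ) < n := by exact_mod_cast hpos
  rw [neg_sub, Real.rpow_sub hn0, Real.rpow_one]

theorem tendsto_floor_rpow_div {t : ℝ} (ht : t < 1) :
    Tendsto (fun n : ℕ => (⌊(n : ℝ) ^ t⌋₊ : ℝ) / n) atTop (𝓝 0) :=
  squeeze_zero (fun n => by positivity) (fun n => div_le_div_of_nonneg_right
    (Nat.floor_le (by positivity)) (Nat.cast_nonneg n)) (tendsto_natCast_rpow_div ht)

theorem isTheta_two_mul_ceil_rpow {t : ℝ} (ht : 0 ≤ t) :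
    (fun n : ℕ => ((2 * ⌈(n : ℝ) ^ t⌉₊ : ℕ) : ℝ)) =Θ[atTop] fun n => (n : ℝ) ^ t := by
  constructor
  · refine IsBigO.of_bound 4 ?_
    filter_upwards [eventually_gt_atTop 0] with n hpos
    have h1 : (1 : ℝ) ≤ (n : ℝ) ^ t := Real.one_le_rpow (by exact_mod_cast hpos) ht
    have h2 := Nat.ceil_lt_add_one (show 0 ≤ (n : ℝ) ^ t by positivity)
    rw [Real.norm_of_nonneg (by positivity), Real.norm_of_nonneg (by positivity)]
    push_cast
    linarith
  · refine IsBigO.of_bound 1 (Eventually.of_forall fun n => ?_)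
    have h2 := Nat.le_ceil ((n : ℝ) ^ t)
    have h3 : (0 : ℝ) ≤ (n : ℝ) ^ t := by positivity
    rw [Real.norm_of_nonneg h3, Real.norm_of_nonneg (by positivity)]
    push_cast
    linarith

theorem tendsto_two_mul_ceil_rpow_div {t : ℝ} (ht0 : 0 ≤ t) (ht : t < 1) :
    Tendsto (fun n : ℕ => ((2 * ⌈(n : ℝ) ^ t⌉₊ : ℕ) : ℝ) / n) atTop (𝓝 0) := by
  have h1 : (fun n : ℕ => (n : ℝ) ^ t) =o[atTop] fun n : ℕ => (n : ℝ) := by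
    refine (isLittleO_iff_tendsto' ?_).2 (tendsto_natCast_rpow_div ht)
    filter_upwards [eventually_gt_atTop 0] with n hpos h0
    exact absurd h0 (by positivity)
  exact ((isTheta_two_mul_ceil_rpow ht0).1.trans_isLittleO h1).tendsto_div_nhds_zero

end Asymptotics

/-! ### Asymptotic typicality and the rate converse -/

section Typicality

variable {A : Type*} [Fintype A] [Nonempty A] {p : A → ℝ}

/-- Sequences are nearly typical, up to a multiple of `n ^ (1 / 2 + γ)` bits, except with
probability at most a multiple of `exp (- n ^ γ)`. -/
theorem exists_eventually_sourceProb_not_isNearlyTypical_le (hp : p ∈ stdSimplex ℝ A) {γ : ℝ}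
    (hγ : γ < 1 / 2) :
    ∃ C K : ℝ, 0 < C ∧ 0 < K ∧ ∀ᶠ n : ℕ in atTop, ∀ η : ℝ, C * (n : ℝ) ^ (1 / 2 + γ) ≤ η →
      sourceProb p (fun x : Fin n → A => ¬ IsNearlyTypical p η x)
        ≤ K * Real.exp (-(n : ℝ) ^ γ) := by
  obtain ⟨C, δ, K, hC, hδ, hK, h⟩ := exists_sourceProb_not_isNearlyTypical_le hp
  refine ⟨C, K, hC, hK, ?_⟩
  filter_upwards [eventually_mul_rpow_le_rpow δ⁻¹ (show 1 / 2 + γ < 1 by linarith),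
    eventually_gt_atTop 0] with n hn hpos η hη
  have hn0 : (0 : ℝ) < n := by exact_mod_cast hpos
  rw [Real.rpow_one, inv_mul_le_iff₀ hδ] at hn
  have h1 := h n _ hpos hn
  have h2 : (n : ℝ) ^ (1 / 2 + γ) / √n = (n : ℝ) ^ γ := by
    rw [Real.sqrt_eq_rpow, ← Real.rpow_sub hn0]; ring_nf
  rw [h2] at h1
  refine (sourceProb_mono hp fun x hx hx' => hx ⟨hx'.1.trans hη, hx'.2.trans ?_⟩).trans h1
  exact Real.rpow_le_rpow_of_exponent_le (by norm_num) (by linarith)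

theorem tendsto_mul_exp_neg_rpow (K : ℝ) {γ : ℝ} (hγ : 0 < γ) :
    Tendsto (fun n : ℕ => K * Real.exp (-(n : ℝ) ^ γ)) atTop (𝓝 0) := by
  simpa using (Real.tendsto_exp_neg_atTop_nhds_zero.comp
    (tendsto_natCast_rpow_atTop hγ)).const_mul K

/-- Typical sequences have probability at most about `2 ^ (-n H)`, so the fewer than `2 ^ (n (H - ε)
+ 1)` short messages cover little mass. Half of `ε` is spent on typicality; the other half gives
exponential decay. -/
theorem tendsto_sourceProb_rate_lt (hp : p ∈ stdSimplex ℝ A) (d : ℕ → ℕ)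
    (C : ∀ n, AdaptiveCode A n (d n)) (herr : Tendsto (fun n => (C n).errorProb p) atTop (𝓝 0))
    {ε : ℝ} (hε : 0 < ε) :
    Tendsto (fun n => sourceProb p (fun x => (C n).rate x < shannonEntropy p - ε))
      atTop (𝓝 0) := by
  set H := shannonEntropy p with hH
  rcases le_or_gt (H - ε) 0 with hR | hR
  · refine tendsto_const_nhds.congr fun n => (Finset.sum_eq_zero fun x _ => if_neg ?_).symm
    refine not_lt.2 (hR.trans ?_)
    unfold AdaptiveCode.rate
    positivity
  obtain ⟨C₀, K, hC₀, hK, htyp⟩ := exists_eventually_sourceProb_not_isNearlyTypical_le hp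
    (γ := 1 / 4) (by norm_num)
  have hlim : Tendsto (fun n : ℕ => (C n).errorProb p
      + K * Real.exp (-(n : ℝ) ^ (1 / 4 : ℝ)) + 2 * Real.exp (-(n * (ε / 2 * Real.log 2))))
      atTop (𝓝 0) := by
    have h3 : Tendsto (fun n : ℕ => Real.exp (-(n * (ε / 2 * Real.log 2)))) atTop (𝓝 0) :=
      Real.tendsto_exp_neg_atTop_nhds_zero.comp
        (tendsto_natCast_atTop_atTop.atTop_mul_const (by
          have := Real.log_pos one_lt_two
          positivity))
    simpa using (herr.add (tendsto_mul_exp_neg_rpow K (by norm_num : (0 : ℝ) < 1 / 4))).add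
      (h3.const_mul 2)
  refine tendsto_of_tendsto_of_tendsto_of_le_of_le' tendsto_const_nhds hlim
    (Eventually.of_forall fun n => sourceProb_nonneg hp _) ?_
  filter_upwards [htyp, eventually_mul_rpow_le_rpow (C₀ / (ε / 2))
    (show (1 : ℝ) / 2 + 1 / 4 < 1 by norm_num), eventually_gt_atTop 0] with n h1 h2 hpos
  have hn0 : (0 : ℝ) < n := by exact_mod_cast hpos
  rw [Real.rpow_one, div_mul_eq_mul_div, div_le_iff₀ (by positivity)] at h2
  have h3 := h1 _ h2
  have h4 := (C n).sourceProb_len_lt_le hp ⌈n * (H - ε)⌉₊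
    (q := (2 : ℝ) ^ (-(n * H) + n * (ε / 2))) (by positivity)
  have h5 : sourceProb p (fun x : Fin n → A => (2 : ℝ) ^ (-(n * H) + n * (ε / 2)) < seqProb p x)
      ≤ K * Real.exp (-(n : ℝ) ^ (1 / 4 : ℝ)) :=
    (sourceProb_mono hp fun x hx hx' => hx.not_ge hx'.2).trans h3
  have h6 : (2 : ℝ) ^ ⌈n * (H - ε)⌉₊ * (2 : ℝ) ^ (-(n * H) + n * (ε / 2))
      ≤ 2 * Real.exp (-(n * (ε / 2 * Real.log 2))) := by
    have h7 := (Nat.ceil_lt_add_one (show 0 ≤ n * (H - ε) by positivity)).le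
    have h8 : Real.exp (-(n * (ε / 2 * Real.log 2))) = (2 : ℝ) ^ (-(n * (ε / 2))) := by
      rw [Real.rpow_def_of_pos (by norm_num)]; ring_nf
    rw [h8, ← Real.rpow_natCast, ← Real.rpow_add (by norm_num)]
    nth_rewrite 3 [← Real.rpow_one 2]
    rw [← Real.rpow_add (by norm_num)]
    exact Real.rpow_le_rpow_of_exponent_le (by norm_num) (by linarith)
  have h9 : sourceProb p (fun x => (C n).rate x < H - ε)
      ≤ sourceProb p (fun x => ((C n).encSel x).len < ⌈n * (H - ε)⌉₊) := by
    refine sourceProb_mono hp fun x hx => ?_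
    rw [AdaptiveCode.rate, div_lt_iff₀ hn0] at hx
    exact Nat.lt_ceil.2 (by linarith)
  linarith

end Typicality

/-! ### The adaptive code -/

section Construction

theorem plugInEntropy_nonneg {A : Type*} [Fintype A] {n : ℕ} (x : Fin n → A) : 0 ≤ plugInEntropy x := by
  refine Finset.sum_nonneg fun a _ => div_nonneg (Real.negMulLog_nonneg ?_ ?_)
    (Real.log_nonneg (by norm_num))
  · rw [empiricalDist_eq]; positivity
  · rw [empiricalDist_eq]
    refine div_le_one_of_le₀ ?_ (Nat.cast_nonneg n)
    exact_mod_cast Nat.lt_succ_iff.1 (letterCounts x a).2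

variable {A : Type*} [Fintype A] [Nonempty A]

/-- The number of bits of a sequence, without those that its seed masks. -/
noncomputable def netLength {n : ℕ} (a : ℕ) (x : Fin n → A) : ℕ :=
  ⌊n * plugInEntropy x⌋₊ - a

open scoped Classical in
theorem exists_adaptive_code (n : ℕ) {a d : ℕ} (had : 2 * a ≤ d) :
    ∃ C : AdaptiveCode A n d,
      (∀ x, (C.encSel x).len = 2 * a + netLength a x) ∧
      (∀ x x' : Fin n → A, plugInEntropy x = plugInEntropy x' → C.encSel x = C.encSel x') ∧
      (∀ x u, C.decSel (C.message x u) = C.encSel x) ∧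
      (∀ p ∈ stdSimplex ℝ A, ∀ x, ∀ s : ℝ, 0 < s → C.uniformityError p x
        ≤ netLength a x * (sourceProb p (fun y : Fin n → A => (typeCard y : ℝ) < s)
          + 2 * (2 ^ netLength a x / s))) ∧
      ((n + 1) ^ Fintype.card A * (2 ^ (a + 1) + 1) ≤ 2 ^ (2 * a) →
        ∀ p, C.errorProb p = 0) := by
  -- One code for each value `b` of the net length. The excess `a + 1` is the margin `a` plus one
  -- bit for the floor.
  choose c hlen hU hD using fun b => exists_universal_code (A := A) n had b (a + 1)
    {x | netLength a x = b}
  let C : AdaptiveCode A n d :=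
    { codes := Finset.univ.image fun x => c (netLength a x)
      encSel := fun x => c (netLength a x)
      -- The net length is the message length minus `2 * a`. A length that never occurs gets an
      -- arbitrary code of the set.
      decSel := fun w => if ∃ x : Fin n → A, netLength a x = w.1 - 2 * a then c (w.1 - 2 * a)
        else c (netLength a (Classical.arbitrary (Fin n → A)))
      encSel_mem := fun x => Finset.mem_image_of_mem _ (Finset.mem_univ x)
      decSel_mem := fun w => by
        split_ifs with h
        · obtain ⟨x, hx⟩ := h
          rw [← hx]
          exact Finset.mem_image_of_mem _ (Finset.mem_univ x)
        · exact Finset.mem_image_of_mem _ (Finset.mem_univ _) }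
  have hdec : ∀ x u, C.decSel (C.message x u) = C.encSel x := by
    intro x u
    have h1 : (C.message x u).1 - 2 * a = netLength a x := by
      change (c (netLength a x)).len - 2 * a = _
      rw [hlen]; omega
    have h2 : C.decSel (C.message x u) = c ((C.message x u).1 - 2 * a) :=
      if_pos ⟨x, h1.symm⟩
    rw [h2, h1]
  refine ⟨C, fun x => hlen _, fun x x' h => ?_, hdec, fun p hp x s hs => hU _ p hp s hs,
    fun hcond p => ?_⟩
  · change c (netLength a x) = c (netLength a x')
    simp only [netLength, h]
  · refine Finset.sum_eq_zero fun x _ => Finset.sum_eq_zero fun u _ => if_neg (not_not.2 ?_)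
    rw [hdec]
    refine hD (netLength a x) (fun y hy => ?_) hcond x rfl u
    have h1 := typeCard_le_rpow y
    have h2 := (Nat.lt_floor_add_one (n * plugInEntropy y)).le
    have h3 : ⌊n * plugInEntropy y⌋₊ ≤ netLength a x + a := by
      rw [← show netLength a y = netLength a x from hy, netLength]; omega
    have h4 : (⌊n * plugInEntropy y⌋₊ : ℝ) ≤ netLength a x + a := by exact_mod_cast h3
    have h5 : (typeCard y : ℝ) ≤ (2 : ℝ) ^ (netLength a x + (a + 1)) := by
      refine h1.trans ?_
      rw [← Real.rpow_natCast]
      refine Real.rpow_le_rpow_of_exponent_le (by norm_num) ?_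
      push_cast
      linarith
    exact_mod_cast h5

end Construction

/-! ### Performance and optimality -/

section Performance

/-- The length exceeds `n` times the plug-in entropy by at least `a - 1` and at most `2 * a`, even
when the subtraction in `netLength` truncates; near typicality adds `a / 4`. -/
theorem abs_rate_sub_le {A : Type*} [Fintype A] {p : A → ℝ} {n d : ℕ} (hn : 0 < n)
    {a : ℕ} (C : AdaptiveCode A n d) (x : Fin n → A)
    (hlen : (C.encSel x).len = 2 * a + netLength a x) (hx : IsNearlyTypical p (a / 4) x) :
    |C.rate x - shannonEntropy p| ≤ 3 * (a / n) + (n : ℝ)⁻¹ := by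
  have hn0 : (0 : ℝ) < n := by exact_mod_cast hn
  have h1 := Nat.floor_le (mul_nonneg hn0.le (plugInEntropy_nonneg x))
  have h2 := Nat.lt_floor_add_one (n * plugInEntropy x)
  obtain ⟨h3, h4⟩ := abs_le.1 hx.1
  have ha : (0 : ℝ) ≤ a := Nat.cast_nonneg a
  have h5 : (netLength a x : ℝ) ≤ ⌊n * plugInEntropy x⌋₊ := by exact_mod_cast Nat.sub_le _ _
  have h6 : (⌊n * plugInEntropy x⌋₊ : ℝ) ≤ netLength a x + a := by
    have : ⌊n * plugInEntropy x⌋₊ ≤ netLength a x + a := by rw [netLength]; omega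
    exact_mod_cast this
  have h7 : C.rate x - shannonEntropy p
      = (2 * a + netLength a x - n * shannonEntropy p) / n := by
    rw [AdaptiveCode.rate, hlen]; push_cast; field_simp
  rw [h7, abs_div, abs_of_pos hn0, div_le_iff₀ hn0]
  have h8 : (3 * ((a : ℝ) / n) + (n : ℝ)⁻¹) * n = 3 * a + 1 := by field_simp
  rw [h8, abs_le]
  constructor <;> linarith

variable {A : Type*} [Fintype A] [Nonempty A] {p : A → ℝ}

/-- Adaptive codes as produced by `exists_adaptive_code` have a uniformity error that is
superpolynomially small on nearly typical sequences. -/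
theorem eventually_uniformityError_le (hp : p ∈ stdSimplex ℝ A) {γ t : ℝ} (hγ0 : 0 < γ)
    (hγ : γ < 1 / 2) (hγt : 1 / 2 + γ < t) (ht : t < 1) (d : ℕ → ℕ)
    (C : ∀ n, AdaptiveCode A n (d n))
    (hU : ∀ n (x : Fin n → A) (s : ℝ), 0 < s → (C n).uniformityError p x
        ≤ netLength ⌊(n : ℝ) ^ t⌋₊ x * (sourceProb p (fun y : Fin n → A => (typeCard y : ℝ) < s)
          + 2 * (2 ^ netLength ⌊(n : ℝ) ^ t⌋₊ x / s))) (r : ℝ) :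
    ∀ᶠ n : ℕ in atTop, ∀ x : Fin n → A, IsNearlyTypical p (⌊(n : ℝ) ^ t⌋₊ / 4) x →
      (C n).uniformityError p x ≤ (n : ℝ) ^ (-r) := by
  set H := shannonEntropy p with hH
  obtain ⟨C₀, K, hC₀, hK, htyp⟩ := exists_eventually_sourceProb_not_isNearlyTypical_le hp hγ
  have hs0 : (0 : ℝ) ≤ 1 / 2 + γ := by linarith
  set k := Fintype.card A
  filter_upwards [htyp, eventually_mul_rpow_le_floor (4 * C₀) hs0 hγt,
    eventually_mul_rpow_le_floor 8 hs0 hγt, eventually_gt_atTop 0,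
    eventually_pow_mul_exp_le ((|H| + 1) * (K + 2 ^ k + 2)) (k + 1) hγ0 r]
    with n h1 h2 h3 hpos h4 x hx
  have hn0 : (0 : ℝ) < n := by exact_mod_cast hpos
  have hn1 : (1 : ℝ) ≤ n := by exact_mod_cast hpos
  set a : ℕ := ⌊(n : ℝ) ^ t⌋₊
  set E := Real.exp (-(n : ℝ) ^ γ) with hE
  have hE0 : 0 < E := Real.exp_pos _
  have hγn : (n : ℝ) ^ γ ≤ (n : ℝ) ^ (1 / 2 + γ) :=
    Real.rpow_le_rpow_of_exponent_le hn1 (by linarith)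
  have ha : (2 : ℝ) ^ (-((a : ℝ) / 4)) ≤ E := by
    rw [Real.rpow_def_of_pos (by norm_num)]
    refine Real.exp_le_exp.2 ?_
    have hl := Real.log_two_gt_d9
    have : (0 : ℝ) ≤ a := Nat.cast_nonneg a
    nlinarith
  have han : (a : ℝ) ≤ n := by
    refine (Nat.floor_le (by positivity)).trans ?_
    nth_rewrite 2 [← Real.rpow_one (n : ℝ)]
    exact Real.rpow_le_rpow_of_exponent_le hn1 ht.le
  set b := netLength a x with hb
  -- On nearly typical `x`, an untruncated `b` is at most `n * H - 3 * a / 4`. Hence `2 ^ b / s` and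
  -- `s * q` are both at most `2 ^ (-a / 4)`.
  set s : ℝ := (2 : ℝ) ^ (n * H - a / 2) with hs
  set q : ℝ := (2 : ℝ) ^ (-(n * H) + a / 4) with hq
  have hs_pos : 0 < s := by positivity
  have hq_pos : 0 < q := by positivity
  have h5 : sourceProb p (fun y : Fin n → A => (typeCard y : ℝ) < s)
      ≤ K * E + (2 * n) ^ k * E := by
    refine (sourceProb_typeCard_lt_le hp hs_pos.le hq_pos.le).trans (add_le_add ?_ ?_)
    · refine (sourceProb_mono hp fun y hy (hy' : IsNearlyTypical p (a / 4) y) =>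
        hy.not_ge hy'.2).trans (h1 (a / 4) ?_)
      linarith
    · have : s * q = (2 : ℝ) ^ (-((a : ℝ) / 4)) := by
        rw [hs, hq, ← Real.rpow_add (by norm_num)]; ring_nf
      rw [this]
      gcongr
      linarith
  have hfloor := Nat.floor_le (mul_nonneg hn0.le (plugInEntropy_nonneg x))
  have hx1 := (abs_le.1 hx.1).2
  have hpoly : (1 : ℝ) ≤ (n : ℝ) ^ k := one_le_pow₀ hn1
  have hbn : (b : ℝ) ≤ n * (|H| + 1) := by
    have h6 : (b : ℝ) ≤ ⌊n * plugInEntropy x⌋₊ := by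
      exact_mod_cast Nat.sub_le _ _
    have h7 : n * H ≤ n * |H| := mul_le_mul_of_nonneg_left (le_abs_self H) hn0.le
    linarith
  have h8 : (b : ℝ) * (2 ^ b / s) ≤ b * E := by
    -- If the subtraction truncates to `b = 0`, then `2 ^ b / s` may be large, but the factor `b`
    -- removes it.
    rcases Nat.eq_zero_or_pos b with h0 | h0
    · simp [h0]
    refine mul_le_mul_of_nonneg_left (le_trans ?_ ha) (Nat.cast_nonneg b)
    have h9 : (b : ℝ) + a = ⌊n * plugInEntropy x⌋₊ := by
      have : b + a = ⌊n * plugInEntropy x⌋₊ := by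
        rw [hb, netLength] at h0 ⊢; omega
      exact_mod_cast this
    rw [hs, ← Real.rpow_natCast, ← Real.rpow_sub (by norm_num)]
    exact Real.rpow_le_rpow_of_exponent_le (by norm_num) (by linarith)
  calc (C n).uniformityError p x
      ≤ b * (sourceProb p (fun y : Fin n → A => (typeCard y : ℝ) < s) + 2 * (2 ^ b / s)) :=
        hU n x s hs_pos
    _ ≤ b * (K * E + (2 * n) ^ k * E) + 2 * (b * E) := by
        have := mul_le_mul_of_nonneg_left h5 (Nat.cast_nonneg (α := ℝ) b)
        linarith
    _ = b * ((K + 2 ^ k * n ^ k + 2) * E) := by rw [mul_pow]; ring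
    _ ≤ n * (|H| + 1) * (((K + 2 ^ k + 2) * n ^ k) * E) := by
        gcongr
        nlinarith
    _ = (|H| + 1) * (K + 2 ^ k + 2) * n ^ (k + 1) * E := by rw [pow_succ]; ring
    _ ≤ _ := h4

/-- A sequence of adaptive codes that compresses every memoryless source to its entropy, with
superpolynomially small uniformity error. -/
theorem exists_universal_adaptive_codes (β : ℝ) (hβ : 0 < β) :
    ∃ C : ∀ n : ℕ, AdaptiveCode A n (2 * ⌈(n : ℝ) ^ (1 / 2 + β)⌉₊),
      (∀ n (x x' : Fin n → A), plugInEntropy x = plugInEntropy x' →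
        (C n).encSel x = (C n).encSel x') ∧
      (∀ n (x : Fin n → A) u, (C n).decSel ((C n).message x u) = (C n).encSel x) ∧
      ∀ p ∈ stdSimplex ℝ A,
        Tendsto (fun n => (C n).errorProb p) atTop (𝓝 0) ∧
        SourceTendstoInProb p (fun n x => (C n).uniformityError p x) 0 ∧
        SourceTendstoInProb p (fun n x => (C n).rate x) (shannonEntropy p) ∧
        (∀ r : ℝ, 0 < r →
          Tendsto (fun n : ℕ => sourceProb p
            (fun x : Fin n → A => (C n).uniformityError p x ≤ (n : ℝ) ^ (-r))) atTop (𝓝 1)) := by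
  -- The cap keeps `t < 1`, so that the margin is `o(n)` even for large `β`; surplus seed bits stay
  -- idle. Halving `δ` puts `1 / 2 + γ` strictly below `t`.
  set δ := min β (1 / 4) with hδ
  have hδ0 : 0 < δ := lt_min hβ (by norm_num)
  have hδ1 : δ ≤ 1 / 4 := min_le_right _ _
  have hδβ : δ ≤ β := min_le_left _ _
  set t := 1 / 2 + δ with ht
  set γ := δ / 2 with hγ
  have hγ0 : 0 < γ := by positivity
  have had : ∀ n : ℕ, 2 * ⌊(n : ℝ) ^ t⌋₊ ≤ 2 * ⌈(n : ℝ) ^ (1 / 2 + β)⌉₊ := by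
    intro n
    refine Nat.mul_le_mul_left 2 ?_
    rcases Nat.eq_zero_or_pos n with rfl | hn
    · rw [Nat.cast_zero, Real.zero_rpow (by positivity), Nat.floor_zero]
      exact Nat.zero_le _
    · refine (Nat.floor_le_floor ?_).trans (Nat.floor_le_ceil _)
      exact Real.rpow_le_rpow_of_exponent_le (by exact_mod_cast hn) (by linarith)
  choose C hlen hsel hdec hU herr using fun n => exists_adaptive_code (A := A) n (had n)
  refine ⟨C, hsel, hdec, fun p hp => ?_⟩
  obtain ⟨C₀, K, hC₀, hK, htyp⟩ := exists_eventually_sourceProb_not_isNearlyTypical_le hp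
    (γ := γ) (by linarith)
  have hs0 : (0 : ℝ) ≤ 1 / 2 + γ := by positivity
  have hst : 1 / 2 + γ < t := by linarith
  have hUs := eventually_uniformityError_le hp hγ0 (by linarith) hst (by linarith) _ C
    (fun n => hU n p hp)
  have hatyp : Tendsto (fun n : ℕ => sourceProb p
      (fun x : Fin n → A => ¬ IsNearlyTypical p (⌊(n : ℝ) ^ t⌋₊ / 4) x)) atTop (𝓝 0) := by
    refine tendsto_of_tendsto_of_tendsto_of_le_of_le' tendsto_const_nhds
      (tendsto_mul_exp_neg_rpow K hγ0) (Eventually.of_forall fun n => sourceProb_nonneg hp _) ?_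
    filter_upwards [htyp, eventually_mul_rpow_le_floor (4 * C₀) hs0 hst] with n h1 h2
    exact h1 _ (by linarith)
  have hzero : ∀ E : ∀ n : ℕ, (Fin n → A) → Prop,
      (∀ᶠ n : ℕ in atTop, ∀ x : Fin n → A, IsNearlyTypical p (⌊(n : ℝ) ^ t⌋₊ / 4) x → ¬ E n x) →
      Tendsto (fun n => sourceProb p (E n)) atTop (𝓝 0) := by
    intro E hE
    refine tendsto_of_tendsto_of_tendsto_of_le_of_le' tendsto_const_nhds hatyp
      (Eventually.of_forall fun n => sourceProb_nonneg hp _) ?_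
    filter_upwards [hE] with n hn
    exact sourceProb_mono hp fun x hx hx' => hn x hx' hx
  refine ⟨?_, fun ε hε => hzero _ ?_, fun ε hε => hzero _ ?_, fun r _ => ?_⟩
  -- The error probability is eventually 0: `2 ^ a` outgrows `4 * (n + 1) ^ |A|`, so there are
  -- enough labels.
  · refine tendsto_const_nhds.congr' ?_
    filter_upwards [eventually_pow_mul_exp_le (4 * 2 ^ Fintype.card A) (Fintype.card A) hγ0 0,
      eventually_mul_rpow_le_floor 2 hs0 hst, eventually_gt_atTop 0] with n h1 h2 hpos
    refine (herr n ?_ p).symm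
    set a : ℕ := ⌊(n : ℝ) ^ t⌋₊
    have hn1 : (1 : ℝ) ≤ n := by exact_mod_cast hpos
    have h3 : Real.exp ((n : ℝ) ^ γ) ≤ (2 : ℝ) ^ a := by
      rw [← Real.rpow_natCast, Real.rpow_def_of_pos (two_pos : (0 : ℝ) < 2)]
      refine Real.exp_le_exp.2 ?_
      have hγn : (n : ℝ) ^ γ ≤ (n : ℝ) ^ (1 / 2 + γ) :=
        Real.rpow_le_rpow_of_exponent_le hn1 (by linarith)
      have hl := Real.log_two_gt_d9
      have : (0 : ℝ) ≤ a := Nat.cast_nonneg a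
      nlinarith
    rw [neg_zero, Real.rpow_zero, Real.exp_neg, ← div_eq_mul_inv,
      div_le_one (Real.exp_pos _)] at h1
    have h4 : ((n : ℝ) + 1) ^ Fintype.card A * 4 ≤ 2 ^ a := by
      calc ((n : ℝ) + 1) ^ Fintype.card A * 4 ≤ (2 * n) ^ Fintype.card A * 4 := by
            gcongr; linarith
        _ = 4 * 2 ^ Fintype.card A * n ^ Fintype.card A := by rw [mul_pow]; ring
        _ ≤ _ := h1.trans h3
    have h5 : (n + 1) ^ Fintype.card A * 4 ≤ 2 ^ a := by exact_mod_cast h4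
    have h6 : 2 ^ (a + 1) + 1 ≤ 4 * 2 ^ a := by
      have := Nat.one_le_two_pow (n := a)
      rw [pow_succ]; omega
    calc (n + 1) ^ Fintype.card A * (2 ^ (a + 1) + 1)
        ≤ (n + 1) ^ Fintype.card A * (4 * 2 ^ a) := Nat.mul_le_mul_left _ h6
      _ = (n + 1) ^ Fintype.card A * 4 * 2 ^ a := by ring
      _ ≤ 2 ^ a * 2 ^ a := Nat.mul_le_mul_right _ h5
      _ = 2 ^ (2 * a) := by rw [← pow_add, two_mul]
  · have hsmall : ∀ᶠ n : ℕ in atTop, (n : ℝ) ^ (-(1 : ℝ)) ≤ ε :=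
      ((tendsto_rpow_neg_atTop one_pos).comp tendsto_natCast_atTop_atTop).eventually_le_const hε
    filter_upwards [hUs 1, hsmall] with n h1 h2 x hx
    have h3 : 0 ≤ (C n).uniformityError p x := uniformityError_nonneg hp _
    rw [sub_zero, abs_of_nonneg h3]
    exact not_lt.2 ((h1 x hx).trans h2)
  · have hsmall : Tendsto (fun n : ℕ => 3 * ((⌊(n : ℝ) ^ t⌋₊ : ℝ) / n) + (n : ℝ)⁻¹)
        atTop (𝓝 0) := by
      simpa using ((tendsto_floor_rpow_div (t := t) (by linarith)).const_mul 3).add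
        (tendsto_inv_atTop_zero.comp (tendsto_natCast_atTop_atTop (R := ℝ)))
    filter_upwards [hsmall.eventually_le_const hε, eventually_gt_atTop 0] with n h1 hpos x hx
    exact not_lt.2 ((abs_rate_sub_le hpos (C n) x (hlen n x) hx).trans h1)
  · have h1 := hzero (fun n x => ¬ (C n).uniformityError p x ≤ (n : ℝ) ^ (-r)) (by
      filter_upwards [hUs r] with n h1 x hx
      exact not_not.2 (h1 x hx))
    have h2 := h1.const_sub 1
    rw [sub_zero] at h2
    exact h2.congr fun n => by linarith [sourceProb_add_not hp (fun x : Fin n → A =>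
      (C n).uniformityError p x ≤ (n : ℝ) ^ (-r))]

theorem achievableRate_shannonEntropy (hp : p ∈ stdSimplex ℝ A) :
    AchievableRate p (shannonEntropy p) := by
  -- Any `β < 1 / 2` makes the seed rate vanish.
  obtain ⟨C, -, -, h⟩ := exists_universal_adaptive_codes (A := A) (1 / 4) (by norm_num)
  obtain ⟨h1, h2, h3, -⟩ := h p hp
  refine ⟨_, C, fun ε hε => ?_, h1, h2,
    tendsto_two_mul_ceil_rpow_div (by norm_num) (by norm_num)⟩
  refine squeeze_zero (fun n => sourceProb_nonneg hp _) (fun n => sourceProb_mono hp ?_) (h3 ε hε)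
  intro x hx
  exact lt_of_lt_of_le (by linarith) (le_abs_self _)

/-- If `R < H`, then for `ε` a third of the gap the rate is above `R + ε` or below `H - ε`; these
events cover everything, yet both probabilities vanish. -/
theorem AchievableRate.shannonEntropy_le (hp : p ∈ stdSimplex ℝ A) {R : ℝ}
    (hR : AchievableRate p R) : shannonEntropy p ≤ R := by
  obtain ⟨d, C, hrate, herr, -, -⟩ := hR
  by_contra! hlt
  set ε := (shannonEntropy p - R) / 3 with hε
  have hε0 : 0 < ε := div_pos (sub_pos.2 hlt) (by norm_num)
  have h1 := (hrate ε hε0).add (tendsto_sourceProb_rate_lt hp d C herr hε0)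
  rw [add_zero] at h1
  refine absurd (ge_of_tendsto' h1 fun n => ?_) (not_le.2 one_pos)
  rw [← sourceProb_add_not hp (fun x => R + ε < (C n).rate x)]
  refine add_le_add_right (sourceProb_mono hp fun x hx => ?_) _
  linarith [not_lt.1 hx]

end Performance

theorem theorem3 {A : Type*} [Fintype A] [Nonempty A] (β : ℝ) (hβ : 0 < β) :
    ∃ (d : ℕ → ℕ) (C : ∀ n, AdaptiveCode A n (d n)),
      -- the seed length
      ((fun n => (d n : ℝ)) =Θ[atTop] fun n => (n : ℝ) ^ (1 / 2 + β)) ∧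
      -- the encoder selects its code through the plug-in entropy estimate
      (∀ n (x x' : Fin n → A), plugInEntropy x = plugInEntropy x' →
        (C n).encSel x = (C n).encSel x') ∧
      -- the decoder selects the same code from the compressed sequence
      (∀ n (x : Fin n → A) (u : Fin (2 ^ d n)),
        (C n).decSel ((C n).message x u) = (C n).encSel x) ∧
      -- performance, for every source distribution
      ∀ p ∈ stdSimplex ℝ A,
        Tendsto (fun n => (C n).errorProb p) atTop (𝓝 0) ∧
        SourceTendstoInProb p (fun n x => (C n).uniformityError p x) 0 ∧
        SourceTendstoInProb p (fun n x => (C n).rate x) (shannonEntropy p) ∧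
        (∀ r : ℝ, 0 < r →
          Tendsto (fun n : ℕ => sourceProb p
            (fun x : Fin n → A => (C n).uniformityError p x ≤ (n : ℝ) ^ (-r))) atTop (𝓝 1)) ∧
        -- optimality of the rate
        IsLeast {R : ℝ | AchievableRate p R} (shannonEntropy p) ∧
        (∀ (d' : ℕ → ℕ) (C' : ∀ n, AdaptiveCode A n (d' n)),
          Tendsto (fun n => (C' n).errorProb p) atTop (𝓝 0) →
          SourceTendstoInProb p (fun n x => (C' n).uniformityError p x) 0 →
          ∀ ε : ℝ, 0 < ε →
            Tendsto (fun n => sourceProb p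
              (fun x => (C' n).rate x < shannonEntropy p - ε)) atTop (𝓝 0)) := by
  obtain ⟨C, hsel, hdec, hperf⟩ := exists_universal_adaptive_codes (A := A) β hβ
  refine ⟨_, C, isTheta_two_mul_ceil_rpow (by positivity), hsel, hdec, fun p hp => ?_⟩
  obtain ⟨h1, h2, h3, h4⟩ := hperf p hp
  exact ⟨h1, h2, h3, h4,
    ⟨achievableRate_shannonEntropy hp, fun R hR => AchievableRate.shannonEntropy_le hp hR⟩,
    fun d' C' herr _ ε hε => tendsto_sourceProb_rate_lt hp d' C' herr hε⟩
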